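/- Consider an infinite two-dimensional grid with vertical lines $x=x_i$ and horizontal lines $y=y_j$ ($i,j\in\mathbb Z$), where $(x_i)$ and $(y_j)$ are strictly increasing and the spacings are arbitrary. Let $m,n\ge 1$ be integers. For a set $D\subset\mathbb R^2$ formed by finitely many closed cells of the grid, let $\mathcal S_{m,n}(D)$ be the real vector space of functions on $D$ that are of class $C^{m-1,n-1}$ (the partial derivatives $\partial_x^i\partial_y^j$ with $i\le m-1$, $j\le n-1$ exist in the interior of $D$ and extend continuously to $D$) and that on each cell of $D$ agree with a polynomial of degree at most $m$ in $x$ and at most $n$ in $y$. Let $f_2$, $f_1^{h,0}$, $f_1^{v,0}$, $f_0^0$ be the numbers of cells of $D$, of horizontal inner edges, of vertical inner edges and of inner vertices of $D$ (an edge is a segment between adjacent grid nodes that is contained in $D$; it is inner if it is not contained in $\partial D$; a vertex is inner if it lies in the interior of $D$). We say that the dimension formula holds for $D$ if $$\dim \mathcal S_{m,n}(D)=(m+1)(n+1)f_2-\bigl((m+1)n\,f_1^{h,0}+(n+1)m\,f_1^{v,0}\bigr)+mn\,f_0^0 .$$ For an integer $k\ge 0$ and a one-dimensional grid, let $\mathcal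 A_k^1$ be the class of sets formed by finitely many cells of that grid such that the number of cells between any two neighbouring connected components exceeds $k$. Lemma. Let $\Omega$ be formed by finitely many cells of the grid and be a two-dimensional topological manifold with boundary. Let a grid line $U'$ split $\Omega$ into two nonempty domains: $\Omega=\Omega_1\cup\Omega_2$, where $\Omega_1,\Omega_2$ are formed by cells and lie in different closed half-planes bounded by $U'$. Put $U=\Omega_1\cap\Omega_2$. Suppose that, with respect to the one-dimensional grid induced on $U'$, $U\in\mathcal A^1_{m-1}$ if $U'$ is horizontal and $U\in\mathcal A^1_{n-1}$ if $U'$ is vertical. If the dimension formula holds for $\Omega_1$ and for $\Omega_2$, then it holds for $\Omega$. -/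

import Mathlib

open Set

noncomputable section

/-! ### One-dimensional grids and the classes of one-dimensional domains -/

/-- `D` is formed by finitely many cells `[t i, t (i + 1)]` of the one-dimensional grid with
nodes `t i`, `i ∈ ℤ`. -/
def FormedByCells₁ (t : ℤ → ℝ) (D : Set ℝ) : Prop :=
  ∃ S : Finset ℤ, D = ⋃ i ∈ S, Icc (t i) (t (i + 1))

/-- The class `𝒜¹_k`: the domains formed by finitely many cells of the grid `t` such that the
number of cells between any two neighbouring segments (connected components) of the domain
exceeds `k`. Two neighbouring segments are described by the gap between them: the first one
ends at a node `t p`, the next one begins at a node `t q`, and no point of `D` lies strictly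
between; the gap then consists of `q - p` cells. -/
def ClassA₁ (t : ℤ → ℝ) (k : ℕ) : Set (Set ℝ) :=
  {D | FormedByCells₁ t D ∧
    ∀ p q : ℤ, p < q → t p ∈ D → t q ∈ D → Ioo (t p) (t q) ∩ D = ∅ → (k : ℤ) < q - p}

/-! ### Two-dimensional grids and domains -/

/-- An infinite two-dimensional grid with vertical grid lines `x = x i` and horizontal grid lines
`y = y j`, `i, j ∈ ℤ`; the distances between adjacent grid lines are arbitrary. -/
structure TensorGrid where
  x : ℤ → ℝ
  y : ℤ → ℝ
  strictMono_x : StrictMono x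
  strictMono_y : StrictMono y

namespace TensorGrid

variable (g : TensorGrid)

/-- The grid node with indices `c`. -/
def node (c : ℤ × ℤ) : ℝ × ℝ := (g.x c.1, g.y c.2)

/-- The closed cell whose lower left corner is the node `c`. -/
def cell (c : ℤ × ℤ) : Set (ℝ × ℝ) :=
  Icc (g.x c.1) (g.x (c.1 + 1)) ×ˢ Icc (g.y c.2) (g.y (c.2 + 1))

/-- The closed horizontal segment from the node `c` to its right neighbour. -/
def hSegment (c : ℤ × ℤ) : Set (ℝ × ℝ) :=
  Icc (g.x c.1) (g.x (c.1 + 1)) ×ˢ {g.y c.2}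

/-- The closed vertical segment from the node `c` to its upper neighbour. -/
def vSegment (c : ℤ × ℤ) : Set (ℝ × ℝ) :=
  {g.x c.1} ×ˢ Icc (g.y c.2) (g.y (c.2 + 1))

/-- `Ω` is formed by finitely many cells of the grid. -/
def FormedByCells (Ω : Set (ℝ × ℝ)) : Prop :=
  ∃ S : Finset (ℤ × ℤ), Ω = ⋃ c ∈ S, g.cell c

/-- A domain: a closed bounded set formed by cells of the grid which is a two-dimensional
topological manifold with boundary (it is Hausdorff and second countable as a subspace of
the plane). -/
def IsDomain (Ω : Set (ℝ × ℝ)) : Prop :=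
  g.FormedByCells Ω ∧ Nonempty (ChartedSpace (EuclideanHalfSpace 2) Ω)

/-- `f₂`: the number of cells of `Ω`. -/
def numCells (Ω : Set (ℝ × ℝ)) : ℕ := {c | g.cell c ⊆ Ω}.ncard

/-- `f₁^{h,0}`: the number of inner horizontal edges of `Ω`, i.e. those not contained in `∂Ω`. -/
def numInnerHEdges (Ω : Set (ℝ × ℝ)) : ℕ :=
  {c | g.hSegment c ⊆ Ω ∧ ¬ g.hSegment c ⊆ frontier Ω}.ncard

/-- `f₁^{v,0}`: the number of inner vertical edges of `Ω`, i.e. those not contained in `∂Ω`. -/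
def numInnerVEdges (Ω : Set (ℝ × ℝ)) : ℕ :=
  {c | g.vSegment c ⊆ Ω ∧ ¬ g.vSegment c ⊆ frontier Ω}.ncard

/-- `f₀⁰`: the number of inner vertices of `Ω`. -/
def numInnerVertices (Ω : Set (ℝ × ℝ)) : ℕ := {c | g.node c ∈ interior Ω}.ncard

/-- The integer
`(m+1)(n+1) f₂ - ((m+1) n f₁^{h,0} + (n+1) m f₁^{v,0}) + m n f₀⁰`. -/
def dimFormula (m n : ℕ) (Ω : Set (ℝ × ℝ)) : ℤ :=
  (m + 1) * (n + 1) * g.numCells Ω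
    - ((m + 1) * n * g.numInnerHEdges Ω + (n + 1) * m * g.numInnerVEdges Ω)
    + m * n * g.numInnerVertices Ω

/-- The vertical grid line with index `k` splits `Ω` into the nonempty domains `Ω₁` and `Ω₂`:
they are formed by cells and lie in different closed half-planes bounded by the line. -/
def SplitsVert (k : ℤ) (Ω Ω₁ Ω₂ : Set (ℝ × ℝ)) : Prop :=
  g.FormedByCells Ω₁ ∧ g.FormedByCells Ω₂ ∧ Ω₁.Nonempty ∧ Ω₂.Nonempty ∧ Ω = Ω₁ ∪ Ω₂ ∧
    ((Ω₁ ⊆ {z | z.1 ≤ g.x k} ∧ Ω₂ ⊆ {z | g.x k ≤ z.1}) ∨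
      (Ω₂ ⊆ {z | z.1 ≤ g.x k} ∧ Ω₁ ⊆ {z | g.x k ≤ z.1}))

/-- The horizontal grid line with index `k` splits `Ω` into the nonempty domains `Ω₁` and `Ω₂`:
they are formed by cells and lie in different closed half-planes bounded by the line. -/
def SplitsHoriz (k : ℤ) (Ω Ω₁ Ω₂ : Set (ℝ × ℝ)) : Prop :=
  g.FormedByCells Ω₁ ∧ g.FormedByCells Ω₂ ∧ Ω₁.Nonempty ∧ Ω₂.Nonempty ∧ Ω = Ω₁ ∪ Ω₂ ∧
    ((Ω₁ ⊆ {z | z.2 ≤ g.y k} ∧ Ω₂ ⊆ {z | g.y k ≤ z.2}) ∨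
      (Ω₂ ⊆ {z | z.2 ≤ g.y k} ∧ Ω₁ ⊆ {z | g.y k ≤ z.2}))

end TensorGrid

/-! ### Spline spaces -/

/-- `f` is of class `C^{r,s}` on `Ω`: the partial derivatives `∂ₓⁱ ∂_yʲ f` with `i ≤ r` and
`j ≤ s` exist in the interior of `Ω` and extend continuously to `Ω`. Here `F i j` is the
(extended) derivative `∂ₓⁱ ∂_yʲ f`; its values outside `Ω` are irrelevant. -/
def IsCrs (r s : ℕ) {Ω : Set (ℝ × ℝ)} (f : Ω → ℝ) : Prop :=
  ∃ F : ℕ → ℕ → ℝ × ℝ → ℝ,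
    (∀ z : Ω, F 0 0 z = f z) ∧
    (∀ i ≤ r, ∀ j ≤ s, ContinuousOn (F i j) Ω) ∧
    (∀ i < r, ∀ j ≤ s, ∀ z ∈ interior Ω,
      HasDerivAt (fun t => F i j (t, z.2)) (F (i + 1) j z) z.1) ∧
    (∀ i ≤ r, ∀ j < s, ∀ z ∈ interior Ω,
      HasDerivAt (fun t => F i j (z.1, t)) (F i (j + 1) z) z.2)

/-- On the subset `C` of `Ω` the function `f` coincides with a polynomial of bi-degree `(m, n)`,
i.e. of degree at most `m` in the first and at most `n` in the second variable. -/
def IsBiPolyOn (m n : ℕ) {Ω : Set (ℝ × ℝ)} (f : Ω → ℝ) (C : Set (ℝ × ℝ)) : Prop :=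
  ∃ a : ℕ → ℕ → ℝ, ∀ z : Ω, (z : ℝ × ℝ) ∈ C →
    f z = ∑ i ∈ Finset.range (m + 1), ∑ j ∈ Finset.range (n + 1),
      a i j * (z : ℝ × ℝ).1 ^ i * (z : ℝ × ℝ).2 ^ j

/-- The spline space `𝒮_{m,n}(𝒯)`, `m, n ≥ 1`, over the mesh `𝒯` which is the portion of the grid
included in `Ω`: the functions of class `C^{m-1,n-1}` on `Ω` which are polynomials of bi-degree
`(m, n)` on each cell of `Ω`. -/
def TensorGrid.splineSpace (g : TensorGrid) (m n : ℕ) (Ω : Set (ℝ × ℝ)) :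
    Submodule ℝ (Ω → ℝ) where
  carrier := {f | IsCrs (m - 1) (n - 1) f ∧ ∀ c : ℤ × ℤ, g.cell c ⊆ Ω → IsBiPolyOn m n f (g.cell c)}
  zero_mem' := by
    refine ⟨⟨fun _ _ _ => 0, fun _ => rfl, ?_, ?_, ?_⟩, fun c _ => ⟨fun _ _ => 0, ?_⟩⟩
    · exact fun _ _ _ _ => continuousOn_const
    · exact fun _ _ _ _ _ _ => hasDerivAt_const _ _
    · exact fun _ _ _ _ _ _ => hasDerivAt_const _ _
    · simp
  add_mem' := by
    rintro f₁ f₂ ⟨⟨F, hF, hFc, hFx, hFy⟩, hf₁⟩ ⟨⟨G, hG, hGc, hGx, hGy⟩, hf₂⟩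
    refine ⟨⟨fun i j z => F i j z + G i j z, ?_, ?_, ?_, ?_⟩, fun c hc => ?_⟩
    · exact fun z => by simp [hF, hG]
    · exact fun i hi j hj => (hFc i hi j hj).add (hGc i hi j hj)
    · exact fun i hi j hj z hz => (hFx i hi j hj z hz).add (hGx i hi j hj z hz)
    · exact fun i hi j hj z hz => (hFy i hi j hj z hz).add (hGy i hi j hj z hz)
    · obtain ⟨a, ha⟩ := hf₁ c hc
      obtain ⟨b, hb⟩ := hf₂ c hc
      refine ⟨fun i j => a i j + b i j, fun z hz => ?_⟩
      simp only [Pi.add_apply, ha z hz, hb z hz, add_mul, Finset.sum_add_distrib]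
  smul_mem' := by
    rintro r f ⟨⟨F, hF, hFc, hFx, hFy⟩, hf⟩
    refine ⟨⟨fun i j z => r * F i j z, ?_, ?_, ?_, ?_⟩, fun c hc => ?_⟩
    · exact fun z => by simp [hF]
    · exact fun i hi j hj => continuousOn_const.mul (hFc i hi j hj)
    · exact fun i hi j hj z hz => (hFx i hi j hj z hz).const_mul r
    · exact fun i hi j hj z hz => (hFy i hi j hj z hz).const_mul r
    · obtain ⟨a, ha⟩ := hf c hc
      refine ⟨fun i j => r * a i j, fun z hz => ?_⟩
      simp only [Pi.smul_apply, smul_eq_mul, ha z hz, Finset.mul_sum, mul_assoc]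

end

/-! ### Cells and nodes of a strictly monotone sequence -/

/-! For a horizontal line the result is the dimension count of a short exact sequence `0 → 𝒮(Ω) →
𝒮(Ω₁) × 𝒮(Ω₂) → 𝒮_m(U)ⁿ → 0`, where `𝒮_m(U)` denotes the univariate `C^{m-1}` splines of degree `m`
on `U`. The first map is restriction; the second is the difference of the traces of `∂_yʲ`, `j < n`,
on `U`.

Exactness in the middle says that two splines glue exactly when these traces agree on `U`. Since `U`
is formed by cells of the line, every common point of `Ω₁` and `Ω₂` lies on a common edge, so
isolated corner contacts do not occur (`finrank_splineFamilies_union`).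

Surjectivity is where the gap condition enters. A gap of at least `m` cells has at least `m + 1`
nodes, and the `m`-th powers of the translates of the variable by `m + 1` distinct nodes span all
polynomials of degree at most `m`. Truncated powers at these nodes therefore change the spline
arbitrarily across the gap, so a spline on `U` extends to the whole line
(`exists_gridSpline_extension`). A Taylor polynomial in `y` then lifts the extended traces to the
plane (`rowTrace_surjective`).

It remains to compare numbers. The dimension of `𝒮_m(U)` is `m + 1` per cell minus `m` per inner
node (`finrank_cellSplines`). Gluing turns each cell of `U` into an inner horizontal edge and each
inner node of `U` into an inner vertex, so the formula drops by `n` times that dimension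
(`dimFormula_union`).

All of this is carried out on families of polynomials, one per cell, which `splineEquiv` identifies
with splines. The vertical case follows by interchanging the coordinates. -/

theorem StrictMono.eq_of_mem_Ioo_of_mem_Icc {t : ℤ → ℝ} (ht : StrictMono t) {a b : ℤ} {u : ℝ}
    (h₁ : u ∈ Ioo (t a) (t (a + 1))) (h₂ : u ∈ Icc (t b) (t (b + 1))) : a = b := by
  have h3 : a < b + 1 := ht.lt_iff_lt.1 (h₁.1.trans_le h₂.2)
  have h4 : b < a + 1 := ht.lt_iff_lt.1 (h₂.1.trans_lt h₁.2)
  omega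

theorem StrictMono.eq_or_of_mem_Icc_of_mem_Icc {t : ℤ → ℝ} (ht : StrictMono t) {a b : ℤ} {u : ℝ}
    (h₁ : u ∈ Icc (t a) (t (a + 1))) (h₂ : u ∈ Icc (t b) (t (b + 1))) :
    a = b ∨ (b = a + 1 ∧ u = t b) ∨ (a = b + 1 ∧ u = t a) := by
  have h3 : a ≤ b + 1 := ht.le_iff_le.1 (h₁.1.trans h₂.2)
  have h4 : b ≤ a + 1 := ht.le_iff_le.1 (h₂.1.trans h₁.2)
  obtain h | h | h : a = b ∨ b = a + 1 ∨ a = b + 1 := by omega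
  · exact Or.inl h
  · subst h; exact Or.inr (Or.inl ⟨rfl, le_antisymm h₁.2 h₂.1⟩)
  · subst h; exact Or.inr (Or.inr ⟨rfl, le_antisymm h₂.2 h₁.1⟩)

theorem StrictMono.midpoint_mem_Ioo {t : ℤ → ℝ} (ht : StrictMono t) (a : ℤ) :
    (t a + t (a + 1)) / 2 ∈ Ioo (t a) (t (a + 1)) := by
  have : t a < t (a + 1) := ht (lt_add_one a)
  constructor <;> linarith

/-! ### Open cells and interiors of unions of cells -/

namespace TensorGrid

variable (g : TensorGrid)

/-- The union of the cells with indices in `S`. -/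
def cellUnion (S : Finset (ℤ × ℤ)) : Set (ℝ × ℝ) := ⋃ c ∈ S, g.cell c

/-- The open cell whose lower left corner is the node `c`. -/
def openCell (c : ℤ × ℤ) : Set (ℝ × ℝ) :=
  Ioo (g.x c.1) (g.x (c.1 + 1)) ×ˢ Ioo (g.y c.2) (g.y (c.2 + 1))

variable {g}

theorem mem_cellUnion {S : Finset (ℤ × ℤ)} {z : ℝ × ℝ} :
    z ∈ g.cellUnion S ↔ ∃ c ∈ S, z ∈ g.cell c := by
  simp [cellUnion]

theorem isOpen_openCell (c : ℤ × ℤ) : IsOpen (g.openCell c) := isOpen_Ioo.prod isOpen_Ioo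

theorem openCell_subset_cell (c : ℤ × ℤ) : g.openCell c ⊆ g.cell c :=
  prod_mono Ioo_subset_Icc_self Ioo_subset_Icc_self

theorem closure_openCell (c : ℤ × ℤ) : closure (g.openCell c) = g.cell c := by
  rw [openCell, closure_prod_eq, closure_Ioo (g.strictMono_x (lt_add_one _)).ne,
    closure_Ioo (g.strictMono_y (lt_add_one _)).ne, cell]

theorem isClosed_cell (c : ℤ × ℤ) : IsClosed (g.cell c) := isClosed_Icc.prod isClosed_Icc

theorem isClosed_cellUnion (S : Finset (ℤ × ℤ)) : IsClosed (g.cellUnion S) :=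
  S.finite_toSet.isClosed_biUnion fun c _ => isClosed_cell c

theorem cell_subset_cellUnion {S : Finset (ℤ × ℤ)} {c : ℤ × ℤ} (hc : c ∈ S) :
    g.cell c ⊆ g.cellUnion S := fun _ hz => mem_cellUnion.2 ⟨c, hc, hz⟩

theorem openCell_subset_interior {S : Finset (ℤ × ℤ)} {c : ℤ × ℤ} (hc : c ∈ S) :
    g.openCell c ⊆ interior (g.cellUnion S) :=
  interior_maximal ((openCell_subset_cell c).trans (cell_subset_cellUnion hc)) (isOpen_openCell c)

theorem eq_of_mem_openCell_of_mem_cell {c d : ℤ × ℤ} {z : ℝ × ℝ} (hc : z ∈ g.openCell c)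
    (hd : z ∈ g.cell d) : c = d :=
  Prod.ext (g.strictMono_x.eq_of_mem_Ioo_of_mem_Icc hc.1 hd.1)
    (g.strictMono_y.eq_of_mem_Ioo_of_mem_Icc hc.2 hd.2)

/-- A neighbourhood of `z` inside the union meets the open cell of `c`, and an open cell meets no
closed cell but its own. This turns the topological definitions of inner edges and vertices into
membership of indices in `S`. -/
theorem mem_of_mem_interior_of_mem_cell {S : Finset (ℤ × ℤ)} {c : ℤ × ℤ} {z : ℝ × ℝ}
    (hz : z ∈ interior (g.cellUnion S)) (hc : z ∈ g.cell c) : c ∈ S := by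
  rw [← closure_openCell] at hc
  obtain ⟨w, hw, hwc⟩ := mem_closure_iff.1 hc _ isOpen_interior hz
  obtain ⟨d, hd, hwd⟩ := mem_cellUnion.1 (interior_subset hw)
  rwa [eq_of_mem_openCell_of_mem_cell hwc hwd]

theorem center_mem_openCell (c : ℤ × ℤ) :
    ((g.x c.1 + g.x (c.1 + 1)) / 2, (g.y c.2 + g.y (c.2 + 1)) / 2) ∈ g.openCell c :=
  ⟨g.strictMono_x.midpoint_mem_Ioo _, g.strictMono_y.midpoint_mem_Ioo _⟩

theorem cell_subset_cellUnion_iff {S : Finset (ℤ × ℤ)} {c : ℤ × ℤ} :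
    g.cell c ⊆ g.cellUnion S ↔ c ∈ S := by
  refine ⟨fun h => ?_, cell_subset_cellUnion⟩
  obtain ⟨d, hd, hwd⟩ :=
    mem_cellUnion.1 (h (openCell_subset_cell c (center_mem_openCell c)))
  rwa [eq_of_mem_openCell_of_mem_cell (center_mem_openCell c) hwd]

/-! ### Counting cells, edges and vertices -/

theorem numCells_cellUnion (S : Finset (ℤ × ℤ)) : g.numCells (g.cellUnion S) = S.card := by
  have : {c | g.cell c ⊆ g.cellUnion S} = (S : Set (ℤ × ℤ)) := by
    ext c; exact cell_subset_cellUnion_iff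
  rw [numCells, this, ncard_coe_finset]

theorem node_mem_interior_cellUnion_iff {S : Finset (ℤ × ℤ)} {c : ℤ × ℤ} :
    g.node c ∈ interior (g.cellUnion S) ↔
      c ∈ S ∧ (c.1 - 1, c.2) ∈ S ∧ (c.1, c.2 - 1) ∈ S ∧ (c.1 - 1, c.2 - 1) ∈ S := by
  have hx := g.strictMono_x.monotone
  have hy := g.strictMono_y.monotone
  have hx0 : g.x (c.1 - 1) < g.x c.1 := g.strictMono_x (by omega)
  have hy0 : g.y (c.2 - 1) < g.y c.2 := g.strictMono_y (by omega)
  have hx1 : g.x c.1 < g.x (c.1 + 1) := g.strictMono_x (by omega)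
  have hy1 : g.y c.2 < g.y (c.2 + 1) := g.strictMono_y (by omega)
  constructor
  · intro h
    refine ⟨?_, ?_, ?_, ?_⟩ <;> refine mem_of_mem_interior_of_mem_cell h ?_ <;>
      simp [node, cell, hx0.le, hy0.le, hx1.le, hy1.le]
  · rintro ⟨h1, h2, h3, h4⟩
    refine interior_maximal (s := g.cellUnion S)
      (t := Ioo (g.x (c.1 - 1)) (g.x (c.1 + 1)) ×ˢ Ioo (g.y (c.2 - 1)) (g.y (c.2 + 1)))
      ?_ (isOpen_Ioo.prod isOpen_Ioo) ⟨⟨hx0, hx1⟩, ⟨hy0, hy1⟩⟩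
    rintro ⟨u, v⟩ ⟨⟨hu0, hu1⟩, ⟨hv0, hv1⟩⟩
    simp only at hu0 hu1 hv0 hv1
    rw [mem_cellUnion]
    rcases le_total u (g.x c.1) with hu | hu <;> rcases le_total v (g.y c.2) with hv | hv
    · exact ⟨_, h4, by simp [cell, *, hu0.le, hv0.le]⟩
    · exact ⟨_, h2, by simp [cell, *, hu0.le, hv1.le]⟩
    · exact ⟨_, h3, by simp [cell, *, hu1.le, hv0.le]⟩
    · exact ⟨_, h1, by simp [cell, *, hu1.le, hv1.le]⟩

theorem not_subset_frontier_cellUnion_iff {S : Finset (ℤ × ℤ)} {e : Set (ℝ × ℝ)}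
    (he : e ⊆ g.cellUnion S) :
    ¬ e ⊆ frontier (g.cellUnion S) ↔ ∃ z ∈ e, z ∈ interior (g.cellUnion S) := by
  rw [(isClosed_cellUnion S).frontier_eq, not_subset]
  refine exists_congr fun z => and_congr_right fun hz => ?_
  simp [he hz]

theorem inner_hSegment_iff {S : Finset (ℤ × ℤ)} {c : ℤ × ℤ} :
    (g.hSegment c ⊆ g.cellUnion S ∧ ¬ g.hSegment c ⊆ frontier (g.cellUnion S)) ↔
      c ∈ S ∧ (c.1, c.2 - 1) ∈ S := by
  have hy0 : g.y (c.2 - 1) < g.y c.2 := g.strictMono_y (by omega)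
  have hy1 : g.y c.2 < g.y (c.2 + 1) := g.strictMono_y (by omega)
  constructor
  · rintro ⟨h, h'⟩
    obtain ⟨⟨u, v⟩, ⟨hu, rfl⟩, hz⟩ := (not_subset_frontier_cellUnion_iff h).1 h'
    refine ⟨mem_of_mem_interior_of_mem_cell hz ⟨hu, ?_⟩,
      mem_of_mem_interior_of_mem_cell hz ⟨hu, ?_⟩⟩ <;> simp [hy0.le, hy1.le]
  · rintro ⟨h1, h2⟩
    have hsub : g.hSegment c ⊆ g.cellUnion S := by
      refine Subset.trans ?_ (cell_subset_cellUnion h1)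
      rintro ⟨u, v⟩ ⟨hu, rfl⟩
      exact ⟨hu, by simp [hy1.le]⟩
    refine ⟨hsub, (not_subset_frontier_cellUnion_iff hsub).2
      ⟨((g.x c.1 + g.x (c.1 + 1)) / 2, g.y c.2),
        ⟨Ioo_subset_Icc_self (g.strictMono_x.midpoint_mem_Ioo _), rfl⟩,
        interior_maximal (s := g.cellUnion S)
      (t := Ioo (g.x c.1) (g.x (c.1 + 1)) ×ˢ Ioo (g.y (c.2 - 1)) (g.y (c.2 + 1)))
      ?_ (isOpen_Ioo.prod isOpen_Ioo) ⟨g.strictMono_x.midpoint_mem_Ioo _, ⟨hy0, hy1⟩⟩⟩⟩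
    rintro ⟨u, v⟩ ⟨⟨hu0, hu1⟩, ⟨hv0, hv1⟩⟩
    simp only at hu0 hu1 hv0 hv1
    rw [mem_cellUnion]
    rcases le_total v (g.y c.2) with hv | hv
    · exact ⟨_, h2, by simp [cell, *, hu0.le, hu1.le, hv0.le]⟩
    · exact ⟨_, h1, by simp [cell, *, hu0.le, hu1.le, hv1.le]⟩

theorem inner_vSegment_iff {S : Finset (ℤ × ℤ)} {c : ℤ × ℤ} :
    (g.vSegment c ⊆ g.cellUnion S ∧ ¬ g.vSegment c ⊆ frontier (g.cellUnion S)) ↔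
      c ∈ S ∧ (c.1 - 1, c.2) ∈ S := by
  have hx0 : g.x (c.1 - 1) < g.x c.1 := g.strictMono_x (by omega)
  have hx1 : g.x c.1 < g.x (c.1 + 1) := g.strictMono_x (by omega)
  constructor
  · rintro ⟨h, h'⟩
    obtain ⟨⟨u, v⟩, ⟨rfl, hv⟩, hz⟩ := (not_subset_frontier_cellUnion_iff h).1 h'
    refine ⟨mem_of_mem_interior_of_mem_cell hz ⟨?_, hv⟩,
      mem_of_mem_interior_of_mem_cell hz ⟨?_, hv⟩⟩ <;> simp [hx0.le, hx1.le]
  · rintro ⟨h1, h2⟩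
    have hsub : g.vSegment c ⊆ g.cellUnion S := by
      refine Subset.trans ?_ (cell_subset_cellUnion h1)
      rintro ⟨u, v⟩ ⟨rfl, hv⟩
      exact ⟨by simp [hx1.le], hv⟩
    refine ⟨hsub, (not_subset_frontier_cellUnion_iff hsub).2
      ⟨(g.x c.1, (g.y c.2 + g.y (c.2 + 1)) / 2),
        ⟨rfl, Ioo_subset_Icc_self (g.strictMono_y.midpoint_mem_Ioo _)⟩,
        interior_maximal (s := g.cellUnion S)
      (t := Ioo (g.x (c.1 - 1)) (g.x (c.1 + 1)) ×ˢ Ioo (g.y c.2) (g.y (c.2 + 1)))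
      ?_ (isOpen_Ioo.prod isOpen_Ioo) ⟨⟨hx0, hx1⟩, g.strictMono_y.midpoint_mem_Ioo _⟩⟩⟩
    rintro ⟨u, v⟩ ⟨⟨hu0, hu1⟩, ⟨hv0, hv1⟩⟩
    simp only at hu0 hu1 hv0 hv1
    rw [mem_cellUnion]
    rcases le_total u (g.x c.1) with hu | hu
    · exact ⟨_, h2, by simp [cell, *, hu0.le, hv0.le, hv1.le]⟩
    · exact ⟨_, h1, by simp [cell, *, hu1.le, hv0.le, hv1.le]⟩

theorem numInnerHEdges_cellUnion (S : Finset (ℤ × ℤ)) :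
    g.numInnerHEdges (g.cellUnion S) = (S.filter fun c => (c.1, c.2 - 1) ∈ S).card := by
  rw [← ncard_coe_finset, numInnerHEdges]
  congr 1
  ext c
  simpa using inner_hSegment_iff

theorem numInnerVEdges_cellUnion (S : Finset (ℤ × ℤ)) :
    g.numInnerVEdges (g.cellUnion S) = (S.filter fun c => (c.1 - 1, c.2) ∈ S).card := by
  rw [← ncard_coe_finset, numInnerVEdges]
  congr 1
  ext c
  simpa using inner_vSegment_iff

theorem numInnerVertices_cellUnion (S : Finset (ℤ × ℤ)) :
    g.numInnerVertices (g.cellUnion S) = (S.filter fun c =>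
      (c.1 - 1, c.2) ∈ S ∧ (c.1, c.2 - 1) ∈ S ∧ (c.1 - 1, c.2 - 1) ∈ S).card := by
  rw [← ncard_coe_finset, numInnerVertices]
  congr 1
  ext c
  simpa using node_mem_interior_cellUnion_iff

end TensorGrid

section Jets

open Polynomial

/-! ### Derivatives of polynomials -/

/-- The value of the `i`-th derivative of a polynomial at `t`. -/
noncomputable def jet (i : ℕ) (t : ℝ) : ℝ[X] →ₗ[ℝ] ℝ := leval t ∘ₗ derivative ^ i

theorem jet_apply (i : ℕ) (t : ℝ) (p : ℝ[X]) : jet i t p = (derivative^[i] p).eval t := by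
  simp [jet, Module.End.pow_apply, leval]

theorem jet_zero (t : ℝ) (p : ℝ[X]) : jet 0 t p = p.eval t := by simp [jet_apply]

theorem hasDerivAt_jet (i : ℕ) (t : ℝ) (p : ℝ[X]) :
    HasDerivAt (fun t => jet i t p) (jet (i + 1) t p) t := by
  simp only [jet_apply, Function.iterate_succ_apply']
  exact (derivative^[i] p).hasDerivAt t

theorem continuous_jet (i : ℕ) (p : ℝ[X]) : Continuous fun t => jet i t p := by
  simp only [jet_apply]
  exact (derivative^[i] p).continuous

/-! ### Polynomials in two variables of bounded bi-degree -/

/-- Polynomials of bi-degree `(m, n)` in `x` and `y`, given by their coefficients at the powers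
of `y`, which are polynomials in `x`. -/
abbrev BiPoly (m n : ℕ) : Type := Fin (n + 1) → degreeLT ℝ (m + 1)

namespace BiPoly

variable {m n : ℕ}

/-- The `j`-th derivative with respect to `y`, restricted to the line with ordinate `y`. -/
noncomputable def trace (j : ℕ) (y : ℝ) : BiPoly m n →ₗ[ℝ] degreeLT ℝ (m + 1) :=
  ∑ q : Fin (n + 1), jet j y (X ^ (q : ℕ)) • LinearMap.proj q

theorem trace_apply (j : ℕ) (y : ℝ) (P : BiPoly m n) :
    trace j y P = ∑ q : Fin (n + 1), jet j y (X ^ (q : ℕ)) • P q := by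
  simp [trace]

/-- The value of the partial derivative `∂ₓⁱ ∂_yʲ` of a polynomial at `z`. -/
noncomputable def pderiv (i j : ℕ) (z : ℝ × ℝ) : BiPoly m n →ₗ[ℝ] ℝ :=
  jet i z.1 ∘ₗ (degreeLT ℝ (m + 1)).subtype ∘ₗ trace j z.2

theorem pderiv_eq_jet_trace (i j : ℕ) (z : ℝ × ℝ) (P : BiPoly m n) :
    pderiv i j z P = jet i z.1 (trace j z.2 P : degreeLT ℝ (m + 1)) := rfl

theorem pderiv_eq_sum (i j : ℕ) (z : ℝ × ℝ) (P : BiPoly m n) :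
    pderiv i j z P = ∑ q : Fin (n + 1), jet j z.2 (X ^ (q : ℕ)) * jet i z.1 (P q : ℝ[X]) := by
  simp [pderiv_eq_jet_trace, trace_apply]

theorem hasDerivAt_pderiv_fst (i j : ℕ) (z : ℝ × ℝ) (P : BiPoly m n) :
    HasDerivAt (fun t => pderiv i j (t, z.2) P) (pderiv (i + 1) j z P) z.1 := by
  simp only [pderiv_eq_jet_trace]
  exact hasDerivAt_jet i z.1 _

theorem hasDerivAt_pderiv_snd (i j : ℕ) (z : ℝ × ℝ) (P : BiPoly m n) :
    HasDerivAt (fun t => pderiv i j (z.1, t) P) (pderiv i (j + 1) z P) z.2 := by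
  simp only [pderiv_eq_sum]
  exact HasDerivAt.fun_sum fun q _ => (hasDerivAt_jet j z.2 _).mul_const _

theorem continuous_pderiv (i j : ℕ) (P : BiPoly m n) : Continuous fun z => pderiv i j z P := by
  simp only [pderiv_eq_sum]
  exact continuous_finsetSum _ fun q _ =>
    ((continuous_jet j _).comp continuous_snd).mul ((continuous_jet i _).comp continuous_fst)

/-- For fixed abscissa, a polynomial in `y` with infinitely many zeros has zero coefficients; each
coefficient is then a polynomial in `x` with infinitely many zeros. -/
theorem eq_zero_of_pderiv_zero {P : BiPoly m n} {a b c d : ℝ} (hab : a < b) (hcd : c < d)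
    (h : ∀ z ∈ Ioo a b ×ˢ Ioo c d, pderiv 0 0 z P = 0) : P = 0 := by
  have key : ∀ u ∈ Ioo a b, ∀ q, (P q : ℝ[X]).eval u = 0 := by
    intro u hu q
    have h0 : ∑ q : Fin (n + 1), C ((P q : ℝ[X]).eval u) * X ^ (q : ℕ) = 0 := by
      refine eq_zero_of_infinite_isRoot _ ((Ioo_infinite hcd).mono fun v hv => ?_)
      have := h (u, v) ⟨hu, hv⟩
      simp only [pderiv_eq_sum, jet_zero, eval_pow, eval_X] at this
      rw [mem_ofPred_eq, IsRoot.def, eval_finsetSum, ← this]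
      exact Finset.sum_congr rfl fun q _ => by rw [eval_C_mul, eval_pow, eval_X, mul_comm]
    have := congrArg (fun p => p.coeff (q : ℕ)) h0
    simpa [finsetSum_coeff, coeff_C_mul, coeff_X_pow, Fin.val_inj] using this
  funext q
  ext1
  exact eq_zero_of_infinite_isRoot _ ((Ioo_infinite hab).mono fun u hu => key u hu q)

theorem pderiv_zero_eq_sum_coeff (P : BiPoly m n) (z : ℝ × ℝ) :
    pderiv 0 0 z P = ∑ i ∈ Finset.range (m + 1), ∑ j : Fin (n + 1),
      (P j : ℝ[X]).coeff i * z.1 ^ i * z.2 ^ (j : ℕ) := by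
  rw [pderiv_eq_sum, Finset.sum_comm]
  refine Finset.sum_congr rfl fun q _ => ?_
  have hd : (P q : ℝ[X]).natDegree < m + 1 := by
    have := mem_degreeLT.1 (P q).2
    by_cases h0 : (P q : ℝ[X]) = 0
    · simp [h0]
    · exact (natDegree_lt_iff_degree_lt h0).2 this
  rw [jet_zero, jet_zero, eval_eq_sum_range' hd]
  simp [Finset.mul_sum, mul_comm]

theorem exists_pderiv_zero_eq_sum (m n : ℕ) (a : ℕ → ℕ → ℝ) :
    ∃ P : BiPoly m n, ∀ z, pderiv 0 0 z P = ∑ i ∈ Finset.range (m + 1),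
      ∑ j ∈ Finset.range (n + 1), a i j * z.1 ^ i * z.2 ^ j := by
  refine ⟨fun q => ⟨∑ i ∈ Finset.range (m + 1), monomial i (a i q), ?_⟩, fun z => ?_⟩
  · exact Submodule.sum_mem _ fun i hi => mem_degreeLT.2
      ((degree_monomial_le _ _).trans_lt (by exact_mod_cast Finset.mem_range.1 hi))
  · rw [pderiv_eq_sum, Finset.sum_comm, ← Fin.sum_univ_eq_sum_range (fun j =>
      ∑ i ∈ Finset.range (m + 1), a i j * z.1 ^ i * z.2 ^ j)]
    refine Finset.sum_congr rfl fun q _ => ?_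
    simp [jet_zero, Finset.mul_sum, mul_comm]

end BiPoly

end Jets

/-! ### Splines as compatible families of polynomials -/

theorem StrictMono.exists_mem_Ico {t : ℤ → ℝ} (ht : StrictMono t) {a : ℤ} {u : ℝ}
    (hu : u ∈ Icc (t a) (t (a + 1))) : ∃ b, u ∈ Ico (t b) (t (b + 1)) := by
  rcases hu.2.lt_or_eq with h | h
  · exact ⟨a, hu.1, h⟩
  · exact ⟨a + 1, h.ge, h.trans_lt (ht (lt_add_one _))⟩

theorem StrictMono.exists_mem_Ioc {t : ℤ → ℝ} (ht : StrictMono t) {a : ℤ} {u : ℝ}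
    (hu : u ∈ Icc (t a) (t (a + 1))) : ∃ b, u ∈ Ioc (t b) (t (b + 1)) := by
  rcases hu.1.lt_or_eq with h | h
  · exact ⟨a, h, hu.2⟩
  · refine ⟨a - 1, ?_, ?_⟩
    · rw [← h]; exact ht (by omega)
    · simp [h]

theorem hasDerivAt_of_eqOn_Icc {φ p q : ℝ → ℝ} {l u r d : ℝ} (hl : l < u) (hr : u < r)
    (hp : ∀ t ∈ Icc l u, φ t = p t) (hq : ∀ t ∈ Icc u r, φ t = q t)
    (hpd : HasDerivAt p d u) (hqd : HasDerivAt q d u) : HasDerivAt φ d u := by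
  have h1 : HasDerivWithinAt φ d (Icc l u) u :=
    hpd.hasDerivWithinAt.congr hp (hp u (right_mem_Icc.2 hl.le))
  have h2 : HasDerivWithinAt φ d (Icc u r) u :=
    hqd.hasDerivWithinAt.congr hq (hq u (left_mem_Icc.2 hr.le))
  have h3 := h1.union h2
  rw [Icc_union_Icc_eq_Icc hl.le hr.le] at h3
  exact h3.hasDerivAt (Icc_mem_nhds hl hr)

namespace TensorGrid

open BiPoly

/-- The families of polynomials of bi-degree `(m, n)` on the cells with indices in `S` whose
partial derivatives `∂ₓⁱ ∂_yʲ` with `i < m`, `j < n` agree where two cells meet. -/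
noncomputable def splineFamilies (g : TensorGrid) (m n : ℕ) (S : Finset (ℤ × ℤ)) :
    Submodule ℝ (S → BiPoly m n) where
  carrier := {P | ∀ c d : S, ∀ z ∈ g.cell c ∩ g.cell d, ∀ i < m, ∀ j < n,
    pderiv i j z (P c) = pderiv i j z (P d)}
  zero_mem' := by simp
  add_mem' := by
    intro P Q hP hQ c d z hz i hi j hj
    simp [hP c d z hz i hi j hj, hQ c d z hz i hi j hj]
  smul_mem' := by
    intro r P hP c d z hz i hi j hj
    simp [hP c d z hz i hi j hj]

variable {g : TensorGrid} {m n : ℕ} {S : Finset (ℤ × ℤ)}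

theorem exists_cell (z : g.cellUnion S) : ∃ c : S, (z : ℝ × ℝ) ∈ g.cell c := by
  obtain ⟨c, hc, hz⟩ := mem_cellUnion.1 z.2
  exact ⟨⟨c, hc⟩, hz⟩

/-- The piecewise values of `∂ₓⁱ ∂_yʲ` of a family of polynomials, on the union of the cells. -/
noncomputable def piecewisePDeriv (g : TensorGrid) {S : Finset (ℤ × ℤ)} (P : S → BiPoly m n)
    (i j : ℕ) (z : ℝ × ℝ) : ℝ :=
  open Classical in
  if h : ∃ c : S, z ∈ g.cell c then pderiv i j z (P h.choose) else 0

theorem piecewisePDeriv_eq {P : S → BiPoly m n} (hP : P ∈ g.splineFamilies m n S) {i j : ℕ}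
    (hi : i < m) (hj : j < n) (c : S) {z : ℝ × ℝ} (hz : z ∈ g.cell c) :
    g.piecewisePDeriv P i j z = pderiv i j z (P c) := by
  have h : ∃ c : S, z ∈ g.cell c := ⟨c, hz⟩
  rw [piecewisePDeriv, dif_pos h]
  exact hP _ _ z ⟨h.choose_spec, hz⟩ i hi j hj

theorem continuousOn_piecewisePDeriv {P : S → BiPoly m n} (hP : P ∈ g.splineFamilies m n S)
    {i j : ℕ} (hi : i < m) (hj : j < n) :
    ContinuousOn (g.piecewisePDeriv P i j) (g.cellUnion S) := by
  have : g.cellUnion S = ⋃ c : S, g.cell c := by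
    ext z; simp [mem_cellUnion]
  rw [this]
  exact (locallyFinite_of_finite _).continuousOn_iUnion (fun c => isClosed_cell _) fun c =>
    (continuous_pderiv i j (P c)).continuousOn.congr fun z hz => piecewisePDeriv_eq hP hi hj c hz

/-- At an interior point the cells to its left and right in the same row both belong to `S` (they
coincide off the vertical grid lines). The two one-sided derivatives agree because compatibility
also covers order `i + 1`. -/
theorem hasDerivAt_piecewisePDeriv_fst {P : S → BiPoly m n} (hP : P ∈ g.splineFamilies m n S)
    {i j : ℕ} (hi : i + 1 < m) (hj : j < n) {z : ℝ × ℝ} (hz : z ∈ interior (g.cellUnion S)) :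
    HasDerivAt (fun t => g.piecewisePDeriv P i j (t, z.2)) (g.piecewisePDeriv P (i + 1) j z)
      z.1 := by
  obtain ⟨c, hc, hzc⟩ := mem_cellUnion.1 (interior_subset hz)
  obtain ⟨a, ha⟩ := g.strictMono_x.exists_mem_Ioc hzc.1
  obtain ⟨b, hb⟩ := g.strictMono_x.exists_mem_Ico hzc.1
  have hza : z ∈ g.cell (a, c.2) := ⟨Ioc_subset_Icc_self ha, hzc.2⟩
  have hzb : z ∈ g.cell (b, c.2) := ⟨Ico_subset_Icc_self hb, hzc.2⟩
  have haS := mem_of_mem_interior_of_mem_cell hz hza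
  have hbS := mem_of_mem_interior_of_mem_cell hz hzb
  refine hasDerivAt_of_eqOn_Icc (p := fun t => pderiv i j (t, z.2) (P ⟨_, haS⟩))
    (q := fun t => pderiv i j (t, z.2) (P ⟨_, hbS⟩)) ha.1 hb.2 (fun t ht => ?_) (fun t ht => ?_)
    ?_ ?_
  · exact piecewisePDeriv_eq hP (by omega) hj ⟨_, haS⟩ ⟨⟨ht.1, ht.2.trans ha.2⟩, hzc.2⟩
  · exact piecewisePDeriv_eq hP (by omega) hj ⟨_, hbS⟩ ⟨⟨hb.1.trans ht.1, ht.2⟩, hzc.2⟩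
  · rw [piecewisePDeriv_eq hP hi hj ⟨_, haS⟩ hza]
    exact hasDerivAt_pderiv_fst i j z _
  · rw [piecewisePDeriv_eq hP hi hj ⟨_, hbS⟩ hzb]
    exact hasDerivAt_pderiv_fst i j z _

theorem hasDerivAt_piecewisePDeriv_snd {P : S → BiPoly m n} (hP : P ∈ g.splineFamilies m n S)
    {i j : ℕ} (hi : i < m) (hj : j + 1 < n) {z : ℝ × ℝ} (hz : z ∈ interior (g.cellUnion S)) :
    HasDerivAt (fun t => g.piecewisePDeriv P i j (z.1, t)) (g.piecewisePDeriv P i (j + 1) z)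
      z.2 := by
  obtain ⟨c, hc, hzc⟩ := mem_cellUnion.1 (interior_subset hz)
  obtain ⟨a, ha⟩ := g.strictMono_y.exists_mem_Ioc hzc.2
  obtain ⟨b, hb⟩ := g.strictMono_y.exists_mem_Ico hzc.2
  have hza : z ∈ g.cell (c.1, a) := ⟨hzc.1, Ioc_subset_Icc_self ha⟩
  have hzb : z ∈ g.cell (c.1, b) := ⟨hzc.1, Ico_subset_Icc_self hb⟩
  have haS := mem_of_mem_interior_of_mem_cell hz hza
  have hbS := mem_of_mem_interior_of_mem_cell hz hzb
  refine hasDerivAt_of_eqOn_Icc (p := fun t => pderiv i j (z.1, t) (P ⟨_, haS⟩))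
    (q := fun t => pderiv i j (z.1, t) (P ⟨_, hbS⟩)) ha.1 hb.2 (fun t ht => ?_) (fun t ht => ?_)
    ?_ ?_
  · exact piecewisePDeriv_eq hP hi (by omega) ⟨_, haS⟩ ⟨hzc.1, ⟨ht.1, ht.2.trans ha.2⟩⟩
  · exact piecewisePDeriv_eq hP hi (by omega) ⟨_, hbS⟩ ⟨hzc.1, ⟨hb.1.trans ht.1, ht.2⟩⟩
  · rw [piecewisePDeriv_eq hP hi hj ⟨_, haS⟩ hza]
    exact hasDerivAt_pderiv_snd i j z _
  · rw [piecewisePDeriv_eq hP hi hj ⟨_, hbS⟩ hzb]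
    exact hasDerivAt_pderiv_snd i j z _

/-- The spline given by a compatible family of polynomials. -/
noncomputable def toSpline (g : TensorGrid) {m n : ℕ} (hm : 1 ≤ m) (hn : 1 ≤ n) (S : Finset (ℤ × ℤ)) :
    g.splineFamilies m n S →ₗ[ℝ] g.splineSpace m n (g.cellUnion S) where
  toFun P := ⟨fun z => g.piecewisePDeriv P.1 0 0 z, by
    refine ⟨⟨g.piecewisePDeriv P.1, fun z => rfl, ?_, ?_, ?_⟩, fun c hc => ?_⟩
    · exact fun i hi j hj => continuousOn_piecewisePDeriv P.2 (by omega) (by omega)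
    · exact fun i hi j hj z hz =>
        hasDerivAt_piecewisePDeriv_fst P.2 (by omega) (by omega) hz
    · exact fun i hi j hj z hz =>
        hasDerivAt_piecewisePDeriv_snd P.2 (by omega) (by omega) hz
    · have hcS := cell_subset_cellUnion_iff.1 hc
      -- Coefficients at powers of `y` above `n` do not enter the sum and are set to zero.
      refine ⟨fun i j => if h : j < n + 1 then
        (P.1 ⟨c, hcS⟩ ⟨j, h⟩ : Polynomial ℝ).coeff i else 0, fun z hz => ?_⟩
      beta_reduce
      rw [piecewisePDeriv_eq P.2 (by omega) (by omega) ⟨c, hcS⟩ hz,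
        pderiv_zero_eq_sum_coeff]
      refine Finset.sum_congr rfl fun i _ => ?_
      rw [Finset.sum_range]
      exact Finset.sum_congr rfl fun j _ => by rw [dif_pos j.2]⟩
  map_add' P Q := by
    ext z
    have h := exists_cell z
    simp [piecewisePDeriv, h]
  map_smul' r P := by
    ext z
    have h := exists_cell z
    simp [piecewisePDeriv, h]

theorem toSpline_apply {hm : 1 ≤ m} {hn : 1 ≤ n} (P : g.splineFamilies m n S)
    (z : g.cellUnion S) : (g.toSpline hm hn S P).1 z = g.piecewisePDeriv P.1 0 0 z := rfl

theorem toSpline_injective (hm : 1 ≤ m) (hn : 1 ≤ n) :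
    Function.Injective (g.toSpline hm hn S) := by
  rw [injective_iff_map_eq_zero]
  intro P hP
  ext1
  funext c
  refine eq_zero_of_pderiv_zero (g.strictMono_x (lt_add_one c.1.1))
    (g.strictMono_y (lt_add_one c.1.2)) fun z hz => ?_
  have hzc : z ∈ g.cell c := openCell_subset_cell _ hz
  rw [← piecewisePDeriv_eq P.2 (by omega) (by omega) c hzc]
  exact congrFun (congrArg Subtype.val hP) ⟨z, cell_subset_cellUnion c.2 hzc⟩

/-- On a cell, the partial derivatives of a function of class `C^{r,s}` are those of the polynomial
with which the function coincides. -/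
theorem eq_pderiv_of_mem_cell {F : ℕ → ℕ → ℝ × ℝ → ℝ} {r s : ℕ}
    (hc : ∀ i ≤ r, ∀ j ≤ s, ContinuousOn (F i j) (g.cellUnion S))
    (hx : ∀ i < r, ∀ j ≤ s, ∀ z ∈ interior (g.cellUnion S),
      HasDerivAt (fun t => F i j (t, z.2)) (F (i + 1) j z) z.1)
    (hy : ∀ i ≤ r, ∀ j < s, ∀ z ∈ interior (g.cellUnion S),
      HasDerivAt (fun t => F i j (z.1, t)) (F i (j + 1) z) z.2)
    {c : ℤ × ℤ} (hcS : c ∈ S) {P : BiPoly m n} (hP : ∀ z ∈ g.cell c, F 0 0 z = pderiv 0 0 z P)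
    {i j : ℕ} (hi : i ≤ r) (hj : j ≤ s) {z : ℝ × ℝ} (hz : z ∈ g.cell c) :
    F i j z = pderiv i j z P := by
  -- On the open cell, uniqueness of derivatives gives the claim by induction, first on `j` with `i
  -- = 0`, then on `i`. Continuity carries it to the closed cell.
  have hopen : ∀ i ≤ r, ∀ j ≤ s, ∀ z ∈ g.openCell c, F i j z = pderiv i j z P := by
    intro i
    induction i with
    | zero =>
      intro _ j
      induction j with
      | zero => exact fun _ z hz => hP z (openCell_subset_cell c hz)
      | succ j ih =>
        intro hj z hz
        refine (hy 0 (by omega) j (by omega) z (openCell_subset_interior hcS hz)).unique ?_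
        refine (hasDerivAt_pderiv_snd 0 j z P).congr_of_eventuallyEq ?_
        filter_upwards [isOpen_Ioo.mem_nhds hz.2] with t ht
        exact ih (by omega) _ ⟨hz.1, ht⟩
    | succ i ih =>
      intro hi j hj z hz
      refine (hx i (by omega) j hj z (openCell_subset_interior hcS hz)).unique ?_
      refine (hasDerivAt_pderiv_fst i j z P).congr_of_eventuallyEq ?_
      filter_upwards [isOpen_Ioo.mem_nhds hz.1] with t ht
      exact ih (by omega) j hj _ ⟨ht, hz.2⟩
  have hsub : EqOn (F i j) (fun z => pderiv i j z P) (closure (g.openCell c)) := by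
    refine EqOn.of_subset_closure (hopen i hi j hj) ?_ (continuous_pderiv i j P).continuousOn
      subset_closure subset_rfl
    rw [closure_openCell]
    exact (hc i hi j hj).mono (cell_subset_cellUnion hcS)
  rw [closure_openCell] at hsub
  exact hsub hz

/-- The extended derivative `F i j` is a single function on the domain. At a point common to two
cells the derivatives of both polynomials equal its value there, hence each other, even where the
cells share only a corner. -/
theorem toSpline_surjective (hm : 1 ≤ m) (hn : 1 ≤ n) :
    Function.Surjective (g.toSpline hm hn S) := by
  rintro ⟨f, ⟨F, hF, hFc, hFx, hFy⟩, hf⟩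
  have hex : ∀ c : S, ∃ P : BiPoly m n, ∀ z ∈ g.cell c, F 0 0 z = pderiv 0 0 z P := by
    intro c
    obtain ⟨a, ha⟩ := hf c (cell_subset_cellUnion c.2)
    obtain ⟨P, hP⟩ := exists_pderiv_zero_eq_sum m n a
    refine ⟨P, fun z hz => ?_⟩
    rw [hP, ← ha ⟨z, cell_subset_cellUnion c.2 hz⟩ hz, ← hF]
  choose P hP using hex
  have hD := fun (c : S) {i j : ℕ} (hi : i ≤ m - 1) (hj : j ≤ n - 1) {z : ℝ × ℝ}
    (hz : z ∈ g.cell c) => eq_pderiv_of_mem_cell hFc hFx hFy c.2 (hP c) hi hj hz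
  have hmem : P ∈ g.splineFamilies m n S := fun c d z hz i hi j hj => by
    rw [← hD c (by omega) (by omega) hz.1, ← hD d (by omega) (by omega) hz.2]
  refine ⟨⟨P, hmem⟩, ?_⟩
  ext z
  obtain ⟨c, hz⟩ := exists_cell z
  rw [toSpline_apply, piecewisePDeriv_eq hmem (by omega) (by omega) c hz, ← hP c z hz, hF]

/-- Splines correspond to compatible families of polynomials. -/
noncomputable def splineEquiv (g : TensorGrid) {m n : ℕ} (hm : 1 ≤ m) (hn : 1 ≤ n) (S : Finset (ℤ × ℤ)) :
    g.splineFamilies m n S ≃ₗ[ℝ] g.splineSpace m n (g.cellUnion S) :=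
  LinearEquiv.ofBijective (g.toSpline hm hn S) ⟨toSpline_injective hm hn, toSpline_surjective hm hn⟩

end TensorGrid

section Univariate

open Polynomial

/-! ### Univariate splines -/

theorem jet_X_sub_C_pow (k i : ℕ) (t : ℝ) :
    jet k t ((X - C t) ^ i) = if k = i then (i.factorial : ℝ) else 0 := by
  rw [jet_apply, iterate_derivative_X_sub_pow]
  rcases lt_trichotomy k i with h | rfl | h
  · simp [h.ne, Nat.sub_ne_zero_of_lt h]
  · simp [Nat.descFactorial_self]
  · simp [h.ne', Nat.descFactorial_eq_zero_iff_lt.2 h]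

theorem X_sub_C_pow_mem_degreeLT {i m : ℕ} (h : i < m) (t : ℝ) : (X - C t) ^ i ∈ degreeLT ℝ m := by
  rw [mem_degreeLT, degree_pow, degree_X_sub_C]
  simpa using h

theorem exists_jet_eq (m : ℕ) (t : ℝ) (w : Fin m → ℝ) :
    ∃ q : degreeLT ℝ (m + 1), ∀ i : Fin m, jet i t (q : ℝ[X]) = w i := by
  refine ⟨∑ i : Fin m, (w i / (i : ℕ).factorial) •
    ⟨(X - C t) ^ (i : ℕ), X_sub_C_pow_mem_degreeLT (by omega) t⟩, fun i => ?_⟩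
  have h : ((i : ℕ).factorial : ℝ) ≠ 0 := by positivity
  simp [jet_X_sub_C_pow, Fin.val_inj, h]

/-- The `m`-th powers of `m + 1` distinct translates of the variable span the polynomials of degree
at most `m`. -/
theorem exists_sum_X_sub_C_pow_eq (m : ℕ) {x : Fin (m + 1) → ℝ} (hx : Function.Injective x)
    (p : degreeLT ℝ (m + 1)) :
    ∃ β : Fin (m + 1) → ℝ, ∑ k, β k • (X - C (x k)) ^ m = (p : ℝ[X]) := by
  -- The coefficient of `X ^ i` in `(X - x k) ^ m` is `m.choose i` times `(-x k) ^ (m - i)`, so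
  -- matching coefficients is a Vandermonde system after division by the binomials.
  have hV : IsUnit (Matrix.vandermonde fun k => -x k) := by
    rw [Matrix.isUnit_iff_isUnit_det, isUnit_iff_ne_zero, Matrix.det_vandermonde_ne_zero_iff]
    exact neg_injective.comp hx
  obtain ⟨β, hβ⟩ := Matrix.vecMul_surjective_iff_isUnit.2 hV
    fun j : Fin (m + 1) => (p : ℝ[X]).coeff (m - j) / (m.choose j)
  refine ⟨β, ?_⟩
  ext i
  by_cases hi : i < m + 1
  · have h := congrFun hβ ⟨m - i, by omega⟩
    have hc : (m.choose i : ℝ) ≠ 0 := by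
      exact_mod_cast (Nat.choose_pos (by omega : i ≤ m)).ne'
    simp only [Matrix.vecMul, dotProduct, Matrix.vandermonde_apply] at h
    rw [Nat.sub_sub_self (by omega), Nat.choose_symm (by omega), eq_div_iff hc] at h
    rw [← h, finsetSum_coeff, Finset.sum_mul]
    refine Finset.sum_congr rfl fun k _ => ?_
    rw [coeff_smul, sub_eq_add_neg, ← C_neg, coeff_X_add_C_pow, smul_eq_mul, mul_assoc]
  · rw [coeff_eq_zero_of_degree_lt, coeff_eq_zero_of_degree_lt]
    · exact (mem_degreeLT.1 p.2).trans_le (by exact_mod_cast not_lt.1 hi)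
    · have : ∑ k, β k • (X - C (x k)) ^ m ∈ degreeLT ℝ (m + 1) :=
        Submodule.sum_mem _ fun k _ =>
          Submodule.smul_mem _ _ (X_sub_C_pow_mem_degreeLT (by omega) _)
      exact (mem_degreeLT.1 this).trans_le (by exact_mod_cast not_lt.1 hi)

/-- Every polynomial of degree at most `m` is a sum of polynomials whose derivatives of order less
than `m` vanish at the respective ones of `m + 1` distinct points. -/
theorem exists_sum_eq_of_injective (m : ℕ) {x : Fin (m + 1) → ℝ} (hx : Function.Injective x)
    (p : degreeLT ℝ (m + 1)) :
    ∃ e : Fin (m + 1) → degreeLT ℝ (m + 1),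
      (∀ k, ∀ i < m, jet i (x k) (e k : ℝ[X]) = 0) ∧ ∑ k, e k = p := by
  obtain ⟨β, hβ⟩ := exists_sum_X_sub_C_pow_eq m hx p
  refine ⟨fun k => β k • ⟨(X - C (x k)) ^ m, X_sub_C_pow_mem_degreeLT (by omega) _⟩,
    fun k i hi => ?_, ?_⟩
  · simp [jet_X_sub_C_pow, hi.ne]
  · ext1
    simp [hβ]

/-- The splines of degree `m` and class `C^{m-1}` on the whole grid with nodes `t a`. -/
noncomputable def gridSplines (t : ℤ → ℝ) (m : ℕ) : Submodule ℝ (ℤ → degreeLT ℝ (m + 1)) where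
  carrier := {s | ∀ a, ∀ i < m, jet i (t a) (s (a - 1) : ℝ[X]) = jet i (t a) (s a : ℝ[X])}
  zero_mem' := by simp
  add_mem' := by
    intro s r hs hr a i hi
    simp [hs a i hi, hr a i hi]
  smul_mem' := by
    intro r s hs a i hi
    simp [hs a i hi]

/-- The splines of degree `m` and class `C^{m-1}` on the union of the cells with indices in `C` of
the grid with nodes `t a`. -/
noncomputable def cellSplines (t : ℤ → ℝ) (m : ℕ) (C : Finset ℤ) :
    Submodule ℝ (C → degreeLT ℝ (m + 1)) where
  carrier := {p | ∀ a b : C, (b : ℤ) = a + 1 →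
    ∀ i < m, jet i (t b) (p a : ℝ[X]) = jet i (t b) (p b : ℝ[X])}
  zero_mem' := by simp
  add_mem' := by
    intro s r hs hr a b hab i hi
    simp [hs a b hab i hi, hr a b hab i hi]
  smul_mem' := by
    intro r s hs a b hab i hi
    simp [hs a b hab i hi]

/-- The function which vanishes before the node `v` and equals `q` after it. -/
def truncated {M : Type*} [Zero M] (v : ℤ) (q : M) (a : ℤ) : M := if v ≤ a then q else 0

theorem truncated_mem_gridSplines {t : ℤ → ℝ} {m : ℕ} {v : ℤ} {q : degreeLT ℝ (m + 1)}
    (hq : ∀ i < m, jet i (t v) (q : ℝ[X]) = 0) : truncated v q ∈ gridSplines t m := by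
  intro a i hi
  rcases lt_trichotomy v a with h | rfl | h
  · simp [truncated, h.le, Int.le_sub_one_iff.2 h]
  · simp [truncated, hq i hi]
  · simp [truncated, h.not_ge, show ¬ v ≤ a - 1 by omega]

/-- The jumps of the derivatives of order less than `m` at the inner nodes. -/
noncomputable def jumps (t : ℤ → ℝ) (m : ℕ) (C : Finset ℤ) :
    (C → degreeLT ℝ (m + 1)) →ₗ[ℝ] ({a ∈ C | a - 1 ∈ C} : Finset ℤ) → Fin m → ℝ :=
  LinearMap.pi fun v => LinearMap.pi fun i =>
    jet i (t v) ∘ₗ (degreeLT ℝ (m + 1)).subtype ∘ₗ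
      (LinearMap.proj ⟨v, (Finset.mem_filter.1 v.2).1⟩ -
        LinearMap.proj ⟨v - 1, (Finset.mem_filter.1 v.2).2⟩)

theorem jumps_apply {t : ℤ → ℝ} {m : ℕ} {C : Finset ℤ} (p : C → degreeLT ℝ (m + 1))
    (v : ({a ∈ C | a - 1 ∈ C} : Finset ℤ)) (i : Fin m) :
    jumps t m C p v i = jet i (t v) (p ⟨v, (Finset.mem_filter.1 v.2).1⟩ : ℝ[X]) -
      jet i (t v) (p ⟨v - 1, (Finset.mem_filter.1 v.2).2⟩ : ℝ[X]) := by
  simp [jumps]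

theorem ker_jumps (t : ℤ → ℝ) (m : ℕ) (C : Finset ℤ) :
    LinearMap.ker (jumps t m C) = cellSplines t m C := by
  ext p
  rw [LinearMap.mem_ker]
  constructor
  · rintro h ⟨a, ha⟩ ⟨b, hb⟩ hab i hi
    have hba : b - 1 = a := by simp only at hab; omega
    subst hba
    have := congrFun (congrFun h ⟨b, Finset.mem_filter.2 ⟨hb, ha⟩⟩) ⟨i, hi⟩
    rw [jumps_apply] at this
    exact (sub_eq_zero.1 this).symm
  · intro h
    funext v i
    rw [jumps_apply]
    exact sub_eq_zero.2 (h ⟨v - 1, _⟩ ⟨v, _⟩ (by simp) i i.2).symm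

/-- A truncated polynomial jumps only at its own node, where its jets of order less than `m` can be
prescribed; summing over the inner nodes realises all jumps independently. -/
theorem jumps_surjective (t : ℤ → ℝ) (m : ℕ) (C : Finset ℤ) :
    Function.Surjective (jumps t m C) := by
  intro w
  choose q hq using fun v => exists_jet_eq m (t v.1) (w v)
  refine ⟨fun a => ∑ v, truncated v.1 (q v) a, ?_⟩
  funext v i
  rw [jumps_apply, ← map_sub, ← Submodule.coe_sub, ← Finset.sum_sub_distrib,
    Finset.sum_eq_single v]
  · simp [truncated, hq]
  · intro u _ huv
    have huv' : u.1 ≠ v.1 := fun h => huv (Subtype.ext h)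
    by_cases h : u.1 ≤ v.1
    · simp [truncated, h, show u.1 ≤ v.1 - 1 by omega]
    · simp [truncated, h, show ¬ u.1 ≤ v.1 - 1 by omega]
  · simp

theorem finrank_degreeLT (m : ℕ) : Module.finrank ℝ (degreeLT ℝ m) = m := by
  rw [(degreeLTEquiv ℝ m).finrank_eq, Module.finrank_fin_fun]

/-- Rank–nullity for the jump map: `m + 1` parameters per cell, `m` independent conditions per inner
node. -/
theorem finrank_cellSplines (t : ℤ → ℝ) (m : ℕ) (C : Finset ℤ) :
    Module.finrank ℝ (cellSplines t m C) + m * (C.filter fun a => a - 1 ∈ C).card =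
      (m + 1) * C.card := by
  have h := (jumps t m C).finrank_range_add_finrank_ker
  rw [LinearMap.range_eq_top.2 (jumps_surjective t m C), finrank_top, ker_jumps] at h
  simp only [Module.finrank_pi_fintype, finrank_degreeLT, Module.finrank_self, Finset.sum_const,
    Finset.card_univ, Fintype.card_coe, Fintype.card_fin, smul_eq_mul] at h
  linarith

/-- If the gaps in `C` have at least `m` cells, every spline on the union of these cells extends to
a spline on the whole grid. -/
theorem exists_gridSpline_extension {t : ℤ → ℝ} (ht : StrictMono t) (m : ℕ) (C : Finset ℤ)
    (hC : ∀ a ∈ C, ∀ b ∈ C, a + 1 < b → (∀ c ∈ C, c ≤ a ∨ b ≤ c) → a + 1 + m ≤ b)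
    {p : C → degreeLT ℝ (m + 1)} (hp : p ∈ cellSplines t m C) :
    ∃ s ∈ gridSplines t m, ∀ a : C, s a = p a := by
  -- Cells are added from left to right: the new cell `N` lies to the right of all earlier ones.
  induction C using Finset.induction_on_max with
  | empty => exact ⟨0, zero_mem _, fun a => absurd a.2 (Finset.notMem_empty _)⟩
  | insert N C hN ih =>
    obtain ⟨s, hs, hsp⟩ := ih
      (fun a ha b hb hab h => hC a (Finset.mem_insert_of_mem ha) b (Finset.mem_insert_of_mem hb) hab
        fun c hc => (Finset.mem_insert.1 hc).elim (fun h => Or.inr (h ▸ (hN b hb).le)) (h c))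
      (p := fun a => p ⟨a, Finset.mem_insert_of_mem a.2⟩)
      (fun a b hab i hi => hp ⟨a, _⟩ ⟨b, _⟩ hab i hi)
    set q := p ⟨N, Finset.mem_insert_self _ _⟩ - s N with hq
    -- A correction of the earlier extension `s` that leaves the cells of `C` untouched and removes
    -- the error `q` on `N`.
    have key : ∃ r ∈ gridSplines t m, r N = q ∧ ∀ a ∈ C, r a = 0 := by
      rcases C.eq_empty_or_nonempty with rfl | hne
      · exact ⟨fun _ => q, fun a i _ => rfl, rfl, by simp⟩
      have hmax := C.max'_mem hne
      have hlt := hN _ hmax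
      have hle : ∀ c ∈ C, c ≤ C.max' hne := fun c hc => C.le_max' c hc
      rcases (Int.add_one_le_iff.2 hlt).eq_or_lt with hadj | hgap
      -- No gap: `s` and `p` agree on the preceding cell and both are smooth at `t N`, so `q`
      -- vanishes there to order `m` and may be switched on at that node.
      · refine ⟨truncated N q, truncated_mem_gridSplines fun i hi => ?_, by simp [truncated],
          fun a ha => by simp [truncated, hN a ha]⟩
        rw [hq, Submodule.coe_sub, map_sub, sub_eq_zero, ← hs N i hi,
          show N - 1 = C.max' hne by omega, hsp ⟨_, hmax⟩]
        exact (hp ⟨_, _⟩ ⟨N, _⟩ hadj.symm i hi).symm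
      · have hm := hC _ (Finset.mem_insert_of_mem hmax) N (Finset.mem_insert_self _ _) hgap
          (by simpa using fun c hc => Or.inl (hle c hc))
        -- The `m + 1` nodes `N - m, …, N` all lie at or after the right end of the last cell of
        -- `C`. Splitting `q` into pieces, each switched on at one of them, leaves `C` unchanged and
        -- reaches `q` on `N`.
        obtain ⟨e, he, heq⟩ := exists_sum_eq_of_injective m (x := fun k => t (N - (k : ℕ)))
          (fun k l h => by have := ht.injective h; apply Fin.ext; omega) q
        refine ⟨∑ k : Fin (m + 1), truncated (N - (k : ℕ)) (e k), Submodule.sum_mem _ fun k _ =>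
          truncated_mem_gridSplines (he k), ?_, fun a ha => ?_⟩
        · simp [truncated, heq]
        · rw [Finset.sum_apply]
          refine Finset.sum_eq_zero fun k _ => if_neg ?_
          have := hle a ha
          have := k.2
          omega
    obtain ⟨r, hr, hrN, hrC⟩ := key
    refine ⟨s + r, add_mem hs hr, ?_⟩
    rintro ⟨a, ha⟩
    rcases Finset.mem_insert.1 ha with rfl | ha
    · simp [hrN, hq]
    · simp [hrC a ha, hsp ⟨a, ha⟩]

end Univariate

section Traces

open Polynomial

/-! ### Traces on a horizontal line -/

theorem sum_jet_X_pow_mul_coeff {n : ℕ} (j : ℕ) (y : ℝ) {p : ℝ[X]} (hp : p ∈ degreeLT ℝ (n + 1)) :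
    ∑ q : Fin (n + 1), jet j y (X ^ (q : ℕ)) * p.coeff q = jet j y p := by
  have h : p = ∑ q : Fin (n + 1), p.coeff q • X ^ (q : ℕ) := by
    ext i
    simp only [finsetSum_coeff, coeff_smul, coeff_X_pow, smul_eq_mul, mul_ite, mul_one, mul_zero]
    by_cases hi : i < n + 1
    · rw [Finset.sum_eq_single ⟨i, hi⟩] <;> simp +contextual [Fin.ext_iff, eq_comm]
    · rw [coeff_eq_zero_of_degree_lt
        ((mem_degreeLT.1 hp).trans_le (by exact_mod_cast not_lt.1 hi)), Finset.sum_eq_zero]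
      intro q _
      rw [if_neg (by omega)]
  conv_rhs => rw [h]
  simp [mul_comm]

namespace BiPoly

variable {m n : ℕ}

/-- The polynomial whose derivatives with respect to `y` of order less than `n` on the line with
ordinate `v` are given. -/
noncomputable def ofTraces (v : ℝ) (w : Fin n → degreeLT ℝ (m + 1)) : BiPoly m n := fun q =>
  ∑ j : Fin n, (((X - C v) ^ (j : ℕ)).coeff q / (j : ℕ).factorial : ℝ) • w j

/-- At every ordinate, not only `v`, the trace is a scalar combination of the `w l`. Smoothness of
the `w l` in `x` is thus inherited along entire vertical edges. -/
theorem trace_ofTraces_eq_sum (j : ℕ) (y v : ℝ) (w : Fin n → degreeLT ℝ (m + 1)) :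
    trace j y (ofTraces v w) =
      ∑ l : Fin n, (jet j y ((X - C v) ^ (l : ℕ)) / (l : ℕ).factorial) • w l := by
  simp only [trace_apply, ofTraces, Finset.smul_sum, smul_smul]
  rw [Finset.sum_comm]
  refine Finset.sum_congr rfl fun l _ => ?_
  rw [← Finset.sum_smul, ← sum_jet_X_pow_mul_coeff j y
    (X_sub_C_pow_mem_degreeLT (by omega : (l : ℕ) < n + 1) v), Finset.sum_div]
  simp only [mul_div_assoc]

theorem trace_ofTraces (j : Fin n) (v : ℝ) (w : Fin n → degreeLT ℝ (m + 1)) :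
    trace j v (ofTraces v w) = w j := by
  have h : ((j : ℕ).factorial : ℝ) ≠ 0 := by positivity
  rw [trace_ofTraces_eq_sum, Finset.sum_eq_single j]
  · simp [jet_X_sub_C_pow, h]
  · intro l _ hl
    simp [jet_X_sub_C_pow, Fin.val_inj, hl.symm]
  · simp

end BiPoly

theorem eq_of_eqOn_Icc {k : ℕ} {p q : degreeLT ℝ k} {a b : ℝ} (hab : a < b)
    (h : ∀ u ∈ Icc a b, jet 0 u (p : ℝ[X]) = jet 0 u (q : ℝ[X])) : p = q := by
  ext1
  refine eq_of_infinite_eval_eq _ _ ((Icc_infinite hab).mono fun u hu => ?_)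
  simpa [jet_zero] using h u hu

end Traces

/-! ### Gluing along a horizontal grid line -/

namespace TensorGrid

open BiPoly

variable {g : TensorGrid} {m n : ℕ} {S S₁ S₂ : Finset (ℤ × ℤ)}

/-- The derivatives of order less than `n` with respect to `y` on the line `y = v`, taken from the
cells of the row with index `r`. -/
noncomputable def rowTrace (g : TensorGrid) (m n : ℕ) {S : Finset (ℤ × ℤ)} {r : ℤ} {v : ℝ}
    (hv : v ∈ Icc (g.y r) (g.y (r + 1))) {C : Finset ℤ} (hC : ∀ a ∈ C, (a, r) ∈ S) :
    g.splineFamilies m n S →ₗ[ℝ] Fin n → cellSplines g.x m C where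
  toFun P j := ⟨fun a => trace j v (P.1 ⟨(a, r), hC a a.2⟩), fun a b hab i hi =>
    P.2 ⟨(a, r), hC a a.2⟩ ⟨(b, r), hC b b.2⟩ (g.x b, v)
      ⟨⟨⟨g.strictMono_x.monotone (by simp [hab]), by simp [hab]⟩, hv⟩,
        ⟨⟨le_rfl, g.strictMono_x.monotone (by simp)⟩, hv⟩⟩ i hi j j.2⟩
  map_add' P Q := by
    funext j
    ext1
    funext a
    simp
  map_smul' c P := by
    funext j
    ext1
    funext a
    simp

theorem rowTrace_apply {r : ℤ} {v : ℝ}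
    {hv : v ∈ Icc (g.y r) (g.y (r + 1))} {C : Finset ℤ} {hC : ∀ a ∈ C, (a, r) ∈ S}
    (P : g.splineFamilies m n S) (j : Fin n) (a : C) :
    (rowTrace g m n hv hC P j).1 a = trace j v (P.1 ⟨(a, r), hC a a.2⟩) := rfl

/-- Extend each prescribed trace to a spline `s j` on the whole line and take the Taylor sum of `s j
(x) (y - v)ʲ / j!`. Its polynomial depends only on the column of the cell, so only matching between
adjacent columns has to be checked. -/
theorem rowTrace_surjective {r : ℤ} {v : ℝ}
    (hv : v ∈ Icc (g.y r) (g.y (r + 1))) {C : Finset ℤ} (hC : ∀ a ∈ C, (a, r) ∈ S)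
    (hgap : ∀ a ∈ C, ∀ b ∈ C, a + 1 < b → (∀ c ∈ C, c ≤ a ∨ b ≤ c) → a + 1 + m ≤ b) :
    Function.Surjective (rowTrace g m n hv hC) := by
  intro w
  choose s hs hsw using fun j =>
    exists_gridSpline_extension g.strictMono_x m C hgap (w j).2
  have hadj : ∀ (a : ℤ) (u v' : ℝ), u = g.x a → ∀ i < m, ∀ j,
      pderiv i j (u, v') (ofTraces v fun l => s l (a - 1)) =
        pderiv i j (u, v') (ofTraces v fun l => s l a) := by
    rintro a _ v' rfl i hi j
    simp only [pderiv_eq_jet_trace, trace_ofTraces_eq_sum, Submodule.coe_sum, Submodule.coe_smul,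
      map_sum, map_smul]
    exact Finset.sum_congr rfl fun l _ => by rw [hs l a i hi]
  refine ⟨⟨fun c => ofTraces v fun j => s j c.1.1, ?_⟩, ?_⟩
  · rintro ⟨c, hc⟩ ⟨d, hd⟩ ⟨u, v'⟩ ⟨hzc, hzd⟩ i hi j hj
    simp only
    rcases g.strictMono_x.eq_or_of_mem_Icc_of_mem_Icc hzc.1 hzd.1 with h | ⟨h, hu⟩ | ⟨h, hu⟩
    · rw [h]
    · rw [← hadj d.1 u v' hu i hi j, h, add_sub_cancel_right]
    · rw [← hadj c.1 u v' hu i hi j, h, add_sub_cancel_right]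
  · funext j
    ext1
    funext a
    rw [rowTrace_apply, trace_ofTraces, hsw]

/-- Restriction of a compatible family to a part of the cells. -/
noncomputable def restrict (g : TensorGrid) (m n : ℕ) {S T : Finset (ℤ × ℤ)} (h : T ⊆ S) :
    g.splineFamilies m n S →ₗ[ℝ] g.splineFamilies m n T where
  toFun P := ⟨fun c => P.1 ⟨c, h c.2⟩, fun c d => P.2 ⟨c, h c.2⟩ ⟨d, h d.2⟩⟩
  map_add' _ _ := rfl
  map_smul' _ _ := rfl

set_option maxSynthPendingDepth 3 in
/-- Splines on two domains which are separated by a horizontal grid line and meet along the cells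
with indices in `C` can be glued if and only if their traces coincide. -/
theorem finrank_splineFamilies_union {k : ℤ} {C : Finset ℤ} (hm : 1 ≤ m)
    (h₁ : ∀ c ∈ S₁, c.2 < k) (h₂ : ∀ c ∈ S₂, k ≤ c.2)
    (hC₁ : ∀ a ∈ C, (a, k - 1) ∈ S₁) (hC₂ : ∀ a ∈ C, (a, k) ∈ S₂)
    (hU : ∀ u, (u, g.y k) ∈ g.cellUnion S₁ → (u, g.y k) ∈ g.cellUnion S₂ →
      ∃ a ∈ C, u ∈ Icc (g.x a) (g.x (a + 1)))
    (hgap : ∀ a ∈ C, ∀ b ∈ C, a + 1 < b → (∀ c ∈ C, c ≤ a ∨ b ≤ c) → a + 1 + m ≤ b) :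
    Module.finrank ℝ (g.splineFamilies m n (S₁ ∪ S₂)) +
        n * Module.finrank ℝ (cellSplines g.x m C) =
      Module.finrank ℝ (g.splineFamilies m n S₁) + Module.finrank ℝ (g.splineFamilies m n S₂) := by
  have hv₁ : g.y k ∈ Icc (g.y (k - 1)) (g.y (k - 1 + 1)) :=
    ⟨g.strictMono_y.monotone (by omega), by simp⟩
  have hv₂ : g.y k ∈ Icc (g.y k) (g.y (k + 1)) := ⟨le_rfl, g.strictMono_y.monotone (by omega)⟩
  let T := (rowTrace g m n hv₁ hC₁).coprod (-rowTrace g m n hv₂ hC₂)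
  -- Splines on the lower part alone already attain all traces.
  have hT : Function.Surjective T := fun w => by
    obtain ⟨P, hP⟩ := rowTrace_surjective (n := n) hv₁ hC₁ hgap w
    exact ⟨(P, 0), by simp [T, hP]⟩
  let R := (restrict g m n (S := S₁ ∪ S₂) Finset.subset_union_left).prod
    (restrict g m n (S := S₁ ∪ S₂) Finset.subset_union_right)
  have hR : Function.Injective R := by
    intro P Q h
    ext1
    funext ⟨c, hc⟩
    rcases Finset.mem_union.1 hc with h' | h'
    · exact congrFun (congrArg (fun z => z.1.1) h) ⟨c, h'⟩
    · exact congrFun (congrArg (fun z => z.2.1) h) ⟨c, h'⟩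
  have hRT : LinearMap.range R = LinearMap.ker T := by
    ext ⟨P₁, P₂⟩
    rw [LinearMap.mem_range, LinearMap.mem_ker]
    constructor
    · rintro ⟨P, hP⟩
      rw [← hP]
      simp only [T, R, LinearMap.prod_apply, LinearMap.coprod_apply, LinearMap.neg_apply,
        ← sub_eq_add_neg]
      rw [sub_eq_zero]
      funext j
      ext1
      funext a
      rw [rowTrace_apply, rowTrace_apply]
      -- Compatibility with `i = 0`, available since `1 ≤ m`, at all points of the common edge
      -- determines the trace polynomial.
      exact eq_of_eqOn_Icc (g.strictMono_x (lt_add_one a.1)) fun u hu =>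
        P.2 ⟨_, _⟩ ⟨_, _⟩ (u, g.y k) ⟨⟨hu, hv₁⟩, ⟨hu, hv₂⟩⟩ 0 hm j j.2
    · intro h
      simp only [T, LinearMap.coprod_apply, LinearMap.neg_apply, ← sub_eq_add_neg] at h
      rw [sub_eq_zero] at h
      -- A common point lies on the line, hence on the edge of some `a ∈ C`. Compare `c` with the
      -- cell below that edge, cross it by equality of traces, then compare the cell above it with
      -- `d`.
      have hcross : ∀ c d : ℤ × ℤ, ∀ hc : c ∈ S₁, ∀ hd : d ∈ S₂, ∀ z ∈ g.cell c ∩ g.cell d,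
          ∀ i < m, ∀ j < n, pderiv i j z (P₁.1 ⟨c, hc⟩) = pderiv i j z (P₂.1 ⟨d, hd⟩) := by
        rintro c d hc hd ⟨u, v⟩ ⟨hzc, hzd⟩ i hi j hj
        have hv : v = g.y k := le_antisymm
          (hzc.2.2.trans (g.strictMono_y.monotone (by have := h₁ c hc; omega)))
          ((g.strictMono_y.monotone (h₂ d hd)).trans hzd.2.1)
        subst hv
        obtain ⟨a, ha, hua⟩ := hU u (mem_cellUnion.2 ⟨c, hc, hzc⟩) (mem_cellUnion.2 ⟨d, hd, hzd⟩)
        rw [P₁.2 ⟨c, hc⟩ ⟨(a, k - 1), hC₁ a ha⟩ (u, g.y k) ⟨hzc, hua, hv₁⟩ i hi j hj,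
          P₂.2 ⟨d, hd⟩ ⟨(a, k), hC₂ a ha⟩ (u, g.y k) ⟨hzd, hua, hv₂⟩ i hi j hj]
        have := congrArg (fun w => (w ⟨j, hj⟩).1 ⟨a, ha⟩) h
        simp only [rowTrace_apply] at this
        rw [pderiv_eq_jet_trace, pderiv_eq_jet_trace, this]
      have hmem₂ : ∀ c ∈ S₁ ∪ S₂, c ∉ S₁ → c ∈ S₂ := fun c hc h =>
        (Finset.mem_union.1 hc).resolve_left h
      refine ⟨⟨fun c => if hc : c.1 ∈ S₁ then P₁.1 ⟨c, hc⟩ else P₂.1 ⟨c, hmem₂ c c.2 hc⟩, ?_⟩, ?_⟩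
      · intro c d z hz i hi j hj
        by_cases hc : c.1 ∈ S₁ <;> by_cases hd : d.1 ∈ S₁
        · simpa only [dif_pos hc, dif_pos hd] using P₁.2 ⟨c, hc⟩ ⟨d, hd⟩ z hz i hi j hj
        · simpa only [dif_pos hc, dif_neg hd] using
            hcross c d hc (hmem₂ d d.2 hd) z hz i hi j hj
        · simpa only [dif_neg hc, dif_pos hd] using
            (hcross d c hd (hmem₂ c c.2 hc) z hz.symm i hi j hj).symm
        · simpa only [dif_neg hc, dif_neg hd] using
            P₂.2 ⟨c, hmem₂ c c.2 hc⟩ ⟨d, hmem₂ d d.2 hd⟩ z hz i hi j hj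
      · refine Prod.ext ?_ ?_ <;> ext1 <;> funext c
        · exact dif_pos c.2
        · exact dif_neg fun hc => by have := h₁ c hc; have := h₂ c c.2; omega
  have h := T.finrank_range_add_finrank_ker
  rw [LinearMap.range_eq_top.2 hT, finrank_top, ← hRT, LinearMap.finrank_range_of_inj hR,
    Module.finrank_prod, Module.finrank_pi_fintype] at h
  simp only [Finset.sum_const, Finset.card_univ, Fintype.card_fin, smul_eq_mul] at h
  omega

end TensorGrid

namespace TensorGrid

variable {g : TensorGrid} {m n : ℕ} {S₁ S₂ : Finset (ℤ × ℤ)}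

/-! ### The dimension formula for a domain split by a horizontal grid line -/

theorem cellUnion_union (S₁ S₂ : Finset (ℤ × ℤ)) :
    g.cellUnion (S₁ ∪ S₂) = g.cellUnion S₁ ∪ g.cellUnion S₂ :=
  Finset.set_biUnion_union _ _ _

/-- Cells and inner vertical edges merely add up. The new inner horizontal edges have index `(a, k)`
with `a ∈ C`; such a node becomes an inner vertex exactly when `a - 1 ∈ C` as well. -/
theorem dimFormula_union {k : ℤ} {C : Finset ℤ} (h₁ : ∀ c ∈ S₁, c.2 < k) (h₂ : ∀ c ∈ S₂, k ≤ c.2)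
    (hC : ∀ a, a ∈ C ↔ (a, k - 1) ∈ S₁ ∧ (a, k) ∈ S₂) :
    g.dimFormula m n (g.cellUnion (S₁ ∪ S₂)) =
      g.dimFormula m n (g.cellUnion S₁) + g.dimFormula m n (g.cellUnion S₂) -
        n * ((m + 1) * C.card - m * (C.filter fun a => a - 1 ∈ C).card) := by
  have hinj : Function.Injective fun a : ℤ => (a, k) := fun a b h => congrArg Prod.fst h
  have hcells : (S₁ ∪ S₂).card = S₁.card + S₂.card := by
    refine Finset.card_union_of_disjoint (Finset.disjoint_left.2 fun c hc hc' => ?_)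
    have := h₁ c hc
    have := h₂ c hc'
    omega
  have hV : ((S₁ ∪ S₂).filter fun c => (c.1 - 1, c.2) ∈ S₁ ∪ S₂).card =
      (S₁.filter fun c => (c.1 - 1, c.2) ∈ S₁).card +
        (S₂.filter fun c => (c.1 - 1, c.2) ∈ S₂).card := by
    rw [← Finset.card_union_of_disjoint]
    · congr 1
      ext ⟨a, b⟩
      have := h₁ (a, b)
      have := h₂ (a, b)
      have := h₁ (a - 1, b)
      have := h₂ (a - 1, b)
      simp only [Finset.mem_filter, Finset.mem_union]
      grind
    · refine Finset.disjoint_left.2 fun c hc hc' => ?_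
      have := h₁ c (Finset.mem_filter.1 hc).1
      have := h₂ c (Finset.mem_filter.1 hc').1
      omega
  have hH : ((S₁ ∪ S₂).filter fun c => (c.1, c.2 - 1) ∈ S₁ ∪ S₂).card =
      (S₁.filter fun c => (c.1, c.2 - 1) ∈ S₁).card +
        (S₂.filter fun c => (c.1, c.2 - 1) ∈ S₂).card + C.card := by
    rw [← Finset.card_image_of_injective C hinj, ← Finset.card_union_of_disjoint,
      ← Finset.card_union_of_disjoint]
    · congr 1
      ext ⟨a, b⟩
      have := h₁ (a, b)
      have := h₂ (a, b)
      have := h₁ (a, b - 1)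
      have := h₂ (a, b - 1)
      have := hC a
      simp only [Finset.mem_filter, Finset.mem_union, Finset.mem_image, Prod.mk.injEq]
      grind
    · refine Finset.disjoint_left.2 fun c hc hc' => ?_
      obtain ⟨a, ha, rfl⟩ := Finset.mem_image.1 hc'
      rcases Finset.mem_union.1 hc with h | h
      · exact (h₁ _ (Finset.mem_filter.1 h).1).ne rfl
      · have := h₂ _ (Finset.mem_filter.1 h).2
        simp at this
    · refine Finset.disjoint_left.2 fun c hc hc' => ?_
      have := h₁ c (Finset.mem_filter.1 hc).1
      have := h₂ c (Finset.mem_filter.1 hc').1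
      omega
  have hN : ((S₁ ∪ S₂).filter fun c => (c.1 - 1, c.2) ∈ S₁ ∪ S₂ ∧ (c.1, c.2 - 1) ∈ S₁ ∪ S₂ ∧
        (c.1 - 1, c.2 - 1) ∈ S₁ ∪ S₂).card =
      (S₁.filter fun c => (c.1 - 1, c.2) ∈ S₁ ∧ (c.1, c.2 - 1) ∈ S₁ ∧
        (c.1 - 1, c.2 - 1) ∈ S₁).card +
      (S₂.filter fun c => (c.1 - 1, c.2) ∈ S₂ ∧ (c.1, c.2 - 1) ∈ S₂ ∧
        (c.1 - 1, c.2 - 1) ∈ S₂).card + (C.filter fun a => a - 1 ∈ C).card := by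
    rw [← Finset.card_image_of_injective _ hinj, ← Finset.card_union_of_disjoint,
      ← Finset.card_union_of_disjoint]
    · congr 1
      ext ⟨a, b⟩
      have := h₁ (a, b)
      have := h₂ (a, b)
      have := h₁ (a, b - 1)
      have := h₂ (a, b - 1)
      have := h₁ (a - 1, b)
      have := h₂ (a - 1, b)
      have := h₁ (a - 1, b - 1)
      have := h₂ (a - 1, b - 1)
      have := hC a
      have := hC (a - 1)
      simp only [Finset.mem_filter, Finset.mem_union, Finset.mem_image, Prod.mk.injEq]
      grind
    · refine Finset.disjoint_left.2 fun c hc hc' => ?_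
      obtain ⟨a, ha, rfl⟩ := Finset.mem_image.1 hc'
      rcases Finset.mem_union.1 hc with h | h
      · exact (h₁ _ (Finset.mem_filter.1 h).1).ne rfl
      · have := h₂ _ (Finset.mem_filter.1 h).2.2.1
        simp at this
    · refine Finset.disjoint_left.2 fun c hc hc' => ?_
      have := h₁ c (Finset.mem_filter.1 hc).1
      have := h₂ c (Finset.mem_filter.1 hc').1
      omega
  simp only [dimFormula, numCells_cellUnion, numInnerHEdges_cellUnion, numInnerVEdges_cellUnion,
    numInnerVertices_cellUnion, hcells, hV, hH, hN]
  push_cast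
  ring

/-- Since `Module.finrank` is zero on infinite-dimensional spaces, finiteness is what makes the
formula a statement about the actual dimension. -/
theorem finite_splineSpace {Ω : Set (ℝ × ℝ)} (hm : 1 ≤ m) (hn : 1 ≤ n) (hΩ : g.FormedByCells Ω) :
    Module.Finite ℝ (g.splineSpace m n Ω) := by
  obtain ⟨S, rfl⟩ := hΩ
  exact Module.Finite.equiv (g.splineEquiv hm hn S)

/-- The gaps between the cells of a domain of class `𝒜¹_{m-1}` have at least `m` cells. -/
theorem le_of_mem_ClassA₁ {t : ℤ → ℝ} (ht : StrictMono t) (hm : 1 ≤ m) {C : Finset ℤ}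
    (hC : (⋃ i ∈ C, Icc (t i) (t (i + 1))) ∈ ClassA₁ t (m - 1)) {a b : ℤ} (ha : a ∈ C) (hb : b ∈ C)
    (hab : a + 1 < b) (h : ∀ c ∈ C, c ≤ a ∨ b ≤ c) : a + 1 + m ≤ b := by
  -- The gap runs from the right node `a + 1` of cell `a` to the left node `b` of cell `b`. Its
  -- length exceeds `m - 1`, which is a true subtraction as `1 ≤ m`.
  have := hC.2 (a + 1) b hab
    (mem_biUnion ha ⟨ht.monotone (by omega), le_rfl⟩)
    (mem_biUnion hb ⟨le_rfl, ht.monotone (by omega)⟩) ?_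
  · omega
  · refine eq_empty_of_forall_notMem ?_
    rintro u ⟨⟨hu₁, hu₂⟩, hu⟩
    obtain ⟨c, hc, hcu⟩ := mem_iUnion₂.1 hu
    have h1 : a + 1 < c + 1 := ht.lt_iff_lt.1 (hu₁.trans_le hcu.2)
    have h2 : c < b := ht.lt_iff_lt.1 (hcu.1.trans_lt hu₂)
    have := h c hc
    omega

theorem finrank_eq_dimFormula_of_below_above {k : ℤ} {Ω₁ Ω₂ : Set (ℝ × ℝ)} (hm : 1 ≤ m)
    (hn : 1 ≤ n) (hf₁ : g.FormedByCells Ω₁) (hf₂ : g.FormedByCells Ω₂)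
    (hb₁ : Ω₁ ⊆ {z | z.2 ≤ g.y k}) (hb₂ : Ω₂ ⊆ {z | g.y k ≤ z.2})
    (hU : {t : ℝ | (t, g.y k) ∈ Ω₁ ∩ Ω₂} ∈ ClassA₁ g.x (m - 1))
    (h₁ : (Module.finrank ℝ (g.splineSpace m n Ω₁) : ℤ) = g.dimFormula m n Ω₁)
    (h₂ : (Module.finrank ℝ (g.splineSpace m n Ω₂) : ℤ) = g.dimFormula m n Ω₂) :
    (Module.finrank ℝ (g.splineSpace m n (Ω₁ ∪ Ω₂)) : ℤ) = g.dimFormula m n (Ω₁ ∪ Ω₂) := by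
  obtain ⟨S₁, rfl⟩ := hf₁
  obtain ⟨S₂, rfl⟩ := hf₂
  obtain ⟨C, hCU⟩ := hU.1
  have hS₁ : ∀ c ∈ S₁, c.2 < k := fun c hc => by
    have := hb₁ (cell_subset_cellUnion (g := g) hc
      (show (g.x c.1, g.y (c.2 + 1)) ∈ _ from ⟨⟨le_rfl, g.strictMono_x.monotone (by omega)⟩,
        ⟨g.strictMono_y.monotone (by omega), le_rfl⟩⟩))
    exact Int.add_one_le_iff.1 (g.strictMono_y.le_iff_le.1 this)
  have hS₂ : ∀ c ∈ S₂, k ≤ c.2 := fun c hc => by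
    have := hb₂ (cell_subset_cellUnion (g := g) hc
      (show g.node c ∈ _ from ⟨⟨le_rfl, g.strictMono_x.monotone (by omega)⟩,
        ⟨le_rfl, g.strictMono_y.monotone (by omega)⟩⟩))
    exact g.strictMono_y.le_iff_le.1 this
  have hmem : ∀ u, (∃ a, ∃ _ : a ∈ C, u ∈ Icc (g.x a) (g.x (a + 1))) ↔
      (u, g.y k) ∈ g.cellUnion S₁ ∧ (u, g.y k) ∈ g.cellUnion S₂ := fun u => by
    have := (Set.ext_iff.1 hCU u).symm
    rwa [mem_iUnion₂] at this
  -- The midpoint of a segment lies in no other column, so it identifies the cells of both parts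
  -- adjacent to the segment.
  have hC : ∀ a, a ∈ C ↔ (a, k - 1) ∈ S₁ ∧ (a, k) ∈ S₂ := by
    intro a
    have hmid := g.strictMono_x.midpoint_mem_Ioo a
    have hmid' := Ioo_subset_Icc_self hmid
    constructor
    · intro ha
      obtain ⟨hu₁, hu₂⟩ := (hmem _).1 ⟨a, ha, hmid'⟩
      obtain ⟨⟨c, r⟩, hc, hcu⟩ := mem_cellUnion.1 hu₁
      obtain ⟨⟨d, s⟩, hd, hdu⟩ := mem_cellUnion.1 hu₂
      obtain rfl := g.strictMono_x.eq_of_mem_Ioo_of_mem_Icc hmid hcu.1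
      obtain rfl := g.strictMono_x.eq_of_mem_Ioo_of_mem_Icc hmid hdu.1
      have hr : k ≤ r + 1 := g.strictMono_y.le_iff_le.1 hcu.2.2
      have hs : s ≤ k := g.strictMono_y.le_iff_le.1 hdu.2.1
      have hr' := hS₁ _ hc
      have hs' := hS₂ _ hd
      simp only at hr' hs'
      obtain rfl : r = k - 1 := by omega
      obtain rfl : s = k := by omega
      exact ⟨hc, hd⟩
    · rintro ⟨hc, hd⟩
      obtain ⟨b, hb, hbu⟩ := (hmem ((g.x a + g.x (a + 1)) / 2)).2
        ⟨mem_cellUnion.2 ⟨_, hc, hmid', g.strictMono_y.monotone (by simp), by simp⟩,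
          mem_cellUnion.2 ⟨_, hd, hmid', le_rfl, g.strictMono_y.monotone (by simp)⟩⟩
      rwa [g.strictMono_x.eq_of_mem_Ioo_of_mem_Icc hmid hbu]
  have hgap : ∀ a ∈ C, ∀ b ∈ C, a + 1 < b → (∀ c ∈ C, c ≤ a ∨ b ≤ c) → a + 1 + m ≤ b := by
    rw [hCU] at hU
    exact fun a ha b hb => le_of_mem_ClassA₁ g.strictMono_x hm hU ha hb
  have hfin := finrank_splineFamilies_union (g := g) (n := n) hm hS₁ hS₂
    (fun a ha => ((hC a).1 ha).1) (fun a ha => ((hC a).1 ha).2)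
    (fun u hu₁ hu₂ => by simpa only [exists_prop] using (hmem u).2 ⟨hu₁, hu₂⟩) hgap
  have hcard := finrank_cellSplines g.x m C
  change (Module.finrank ℝ (g.splineSpace m n (g.cellUnion S₁)) : ℤ) =
    g.dimFormula m n (g.cellUnion S₁) at h₁
  change (Module.finrank ℝ (g.splineSpace m n (g.cellUnion S₂)) : ℤ) =
    g.dimFormula m n (g.cellUnion S₂) at h₂
  change (Module.finrank ℝ (g.splineSpace m n (g.cellUnion S₁ ∪ g.cellUnion S₂)) : ℤ) =
    g.dimFormula m n (g.cellUnion S₁ ∪ g.cellUnion S₂)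
  rw [← cellUnion_union, dimFormula_union hS₁ hS₂ hC, ← h₁, ← h₂]
  rw [(g.splineEquiv hm hn S₁).finrank_eq, (g.splineEquiv hm hn S₂).finrank_eq,
    (g.splineEquiv hm hn (S₁ ∪ S₂)).finrank_eq] at hfin
  zify at hfin hcard
  linear_combination hfin - n * hcard

theorem finrank_eq_dimFormula_of_splitsHoriz {k : ℤ} {Ω Ω₁ Ω₂ : Set (ℝ × ℝ)} (hm : 1 ≤ m)
    (hn : 1 ≤ n) (hΩ : g.SplitsHoriz k Ω Ω₁ Ω₂)
    (hU : {t : ℝ | (t, g.y k) ∈ Ω₁ ∩ Ω₂} ∈ ClassA₁ g.x (m - 1))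
    (h₁ : (Module.finrank ℝ (g.splineSpace m n Ω₁) : ℤ) = g.dimFormula m n Ω₁)
    (h₂ : (Module.finrank ℝ (g.splineSpace m n Ω₂) : ℤ) = g.dimFormula m n Ω₂) :
    (Module.finrank ℝ (g.splineSpace m n Ω) : ℤ) = g.dimFormula m n Ω := by
  obtain ⟨hf₁, hf₂, -, -, rfl, ⟨hb₁, hb₂⟩ | ⟨hb₂, hb₁⟩⟩ := hΩ
  · exact finrank_eq_dimFormula_of_below_above hm hn hf₁ hf₂ hb₁ hb₂ hU h₁ h₂
  · rw [union_comm]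
    rw [inter_comm] at hU
    exact finrank_eq_dimFormula_of_below_above hm hn hf₂ hf₁ hb₂ hb₁ hU h₂ h₁

/-! ### Transposition -/

/-- The grid with the two coordinates interchanged. -/
noncomputable def transpose (g : TensorGrid) : TensorGrid := ⟨g.y, g.x, g.strictMono_y, g.strictMono_x⟩

theorem cell_transpose (c : ℤ × ℤ) : g.transpose.cell c = Prod.swap ⁻¹' g.cell c.swap :=
  (preimage_swap_prod _ _).symm

theorem hSegment_transpose (c : ℤ × ℤ) :
    g.transpose.hSegment c = Prod.swap ⁻¹' g.vSegment c.swap :=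
  (preimage_swap_prod _ _).symm

theorem vSegment_transpose (c : ℤ × ℤ) :
    g.transpose.vSegment c = Prod.swap ⁻¹' g.hSegment c.swap :=
  (preimage_swap_prod _ _).symm

theorem FormedByCells.transpose {Ω : Set (ℝ × ℝ)} (h : g.FormedByCells Ω) :
    g.transpose.FormedByCells (Prod.swap ⁻¹' Ω) := by
  obtain ⟨S, rfl⟩ := h
  refine ⟨S.image Prod.swap, ?_⟩
  rw [Finset.set_biUnion_finset_image, preimage_iUnion₂]
  simp only [cell_transpose, Prod.swap_swap]

theorem interior_preimage_swap (Ω : Set (ℝ × ℝ)) :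
    interior (Prod.swap ⁻¹' Ω) = Prod.swap ⁻¹' interior Ω :=
  ((Homeomorph.prodComm ℝ ℝ).preimage_interior Ω).symm

theorem frontier_preimage_swap (Ω : Set (ℝ × ℝ)) :
    frontier (Prod.swap ⁻¹' Ω) = Prod.swap ⁻¹' frontier Ω :=
  ((Homeomorph.prodComm ℝ ℝ).preimage_frontier Ω).symm

theorem ncard_preimage_swap (A : Set (ℤ × ℤ)) : (Prod.swap ⁻¹' A).ncard = A.ncard :=
  ncard_preimage_of_injective_subset_range Prod.swap_injective
    (by simp [Prod.swap_surjective.range_eq])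

theorem dimFormula_transpose (m n : ℕ) (Ω : Set (ℝ × ℝ)) :
    g.transpose.dimFormula n m (Prod.swap ⁻¹' Ω) = g.dimFormula m n Ω := by
  have hc : g.transpose.numCells (Prod.swap ⁻¹' Ω) = g.numCells Ω := by
    rw [numCells, numCells, ← ncard_preimage_swap]
    simp only [cell_transpose, preimage_subset_preimage_iff, Prod.swap_surjective.range_eq,
      subset_univ]
    rfl
  have hh : g.transpose.numInnerHEdges (Prod.swap ⁻¹' Ω) = g.numInnerVEdges Ω := by
    rw [numInnerHEdges, numInnerVEdges, ← ncard_preimage_swap]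
    simp only [hSegment_transpose, frontier_preimage_swap, preimage_subset_preimage_iff,
      Prod.swap_surjective.range_eq, subset_univ]
    rfl
  have hv : g.transpose.numInnerVEdges (Prod.swap ⁻¹' Ω) = g.numInnerHEdges Ω := by
    rw [numInnerHEdges, numInnerVEdges, ← ncard_preimage_swap]
    simp only [vSegment_transpose, frontier_preimage_swap, preimage_subset_preimage_iff,
      Prod.swap_surjective.range_eq, subset_univ]
    rfl
  have hn : g.transpose.numInnerVertices (Prod.swap ⁻¹' Ω) = g.numInnerVertices Ω := by
    rw [numInnerVertices, numInnerVertices, ← ncard_preimage_swap, interior_preimage_swap]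
    rfl
  simp only [dimFormula, hc, hh, hv, hn]
  ring

/-- The derivative of order `(i, j)` of the transposed function is the transposed derivative of
order `(j, i)`; hence the exchange of `m` and `n`. -/
theorem mem_splineSpace_transpose {Ω : Set (ℝ × ℝ)} {f : Ω → ℝ} (hf : f ∈ g.splineSpace m n Ω) :
    (fun z : Prod.swap ⁻¹' Ω => f ⟨z.1.swap, z.2⟩) ∈
      g.transpose.splineSpace n m (Prod.swap ⁻¹' Ω) := by
  obtain ⟨⟨F, hF, hFc, hFx, hFy⟩, hP⟩ := hf
  refine ⟨⟨fun i j z => F j i z.swap, fun z => hF ⟨z.1.swap, z.2⟩, ?_, ?_, ?_⟩, fun c hc => ?_⟩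
  · exact fun i hi j hj => (hFc j hj i hi).comp continuous_swap.continuousOn (mapsTo_preimage _ _)
  · intro i hi j hj z hz
    rw [interior_preimage_swap] at hz
    exact hFy j hj i hi z.swap hz
  · intro i hi j hj z hz
    rw [interior_preimage_swap] at hz
    exact hFx j hj i hi z.swap hz
  · rw [cell_transpose,
      preimage_subset_preimage_iff (by simp [Prod.swap_surjective.range_eq])] at hc
    obtain ⟨a, ha⟩ := hP c.swap hc
    refine ⟨fun i j => a j i, fun z hz => ?_⟩
    rw [cell_transpose] at hz
    beta_reduce
    rw [ha ⟨z.1.swap, z.2⟩ hz, Finset.sum_comm]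
    exact Finset.sum_congr rfl fun i _ => Finset.sum_congr rfl fun j _ => by
      simp only [Prod.fst_swap, Prod.snd_swap]; ring

/-- Interchanging the coordinates identifies spline spaces. -/
noncomputable def splineSpaceTranspose (g : TensorGrid) (m n : ℕ) (Ω : Set (ℝ × ℝ)) :
    g.splineSpace m n Ω ≃ₗ[ℝ] g.transpose.splineSpace n m (Prod.swap ⁻¹' Ω) where
  toFun f := ⟨_, mem_splineSpace_transpose f.2⟩
  -- Transposing twice returns the grid and the domain definitionally, so the same lemma serves for
  -- the inverse.
  invFun f := ⟨fun z => f.1 ⟨z.1.swap, z.2⟩, mem_splineSpace_transpose f.2⟩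
  map_add' _ _ := rfl
  map_smul' _ _ := rfl
  left_inv _ := rfl
  right_inv _ := rfl

theorem SplitsVert.transpose {k : ℤ} {Ω Ω₁ Ω₂ : Set (ℝ × ℝ)} (h : g.SplitsVert k Ω Ω₁ Ω₂) :
    g.transpose.SplitsHoriz k (Prod.swap ⁻¹' Ω) (Prod.swap ⁻¹' Ω₁) (Prod.swap ⁻¹' Ω₂) := by
  obtain ⟨hf₁, hf₂, hn₁, hn₂, rfl, hs⟩ := h
  exact ⟨hf₁.transpose, hf₂.transpose, hn₁.preimage Prod.swap_surjective,
    hn₂.preimage Prod.swap_surjective, rfl,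
    hs.imp (fun h => ⟨fun _ hz => h.1 hz, fun _ hz => h.2 hz⟩)
      fun h => ⟨fun _ hz => h.1 hz, fun _ hz => h.2 hz⟩⟩

end TensorGrid

theorem mainTheorem4 (g : TensorGrid) (m n : ℕ) (hm : 1 ≤ m) (hn : 1 ≤ n)
    (Ω Ω₁ Ω₂ : Set (ℝ × ℝ)) (hΩ : g.IsDomain Ω)
    (hU :
      (∃ k : ℤ, g.SplitsHoriz k Ω Ω₁ Ω₂ ∧
        {t : ℝ | (t, g.y k) ∈ Ω₁ ∩ Ω₂} ∈ ClassA₁ g.x (m - 1)) ∨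
      (∃ k : ℤ, g.SplitsVert k Ω Ω₁ Ω₂ ∧
        {t : ℝ | (g.x k, t) ∈ Ω₁ ∩ Ω₂} ∈ ClassA₁ g.y (n - 1)))
    (h₁ : (Module.finrank ℝ (g.splineSpace m n Ω₁) : ℤ) = g.dimFormula m n Ω₁)
    (h₂ : (Module.finrank ℝ (g.splineSpace m n Ω₂) : ℤ) = g.dimFormula m n Ω₂) :
    Module.Finite ℝ (g.splineSpace m n Ω) ∧
      (Module.finrank ℝ (g.splineSpace m n Ω) : ℤ) = g.dimFormula m n Ω := by
  refine ⟨TensorGrid.finite_splineSpace hm hn hΩ.1, ?_⟩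
  obtain ⟨k, hs, hU⟩ | ⟨k, hs, hU⟩ := hU
  · exact TensorGrid.finrank_eq_dimFormula_of_splitsHoriz hm hn hs hU h₁ h₂
  -- Transposition makes the vertical line horizontal, with `m` and `n` exchanged; this is why the
  -- gap condition here involves `n - 1`.
  · rw [(g.splineSpaceTranspose m n _).finrank_eq, ← g.dimFormula_transpose] at h₁ h₂ ⊢
    exact TensorGrid.finrank_eq_dimFormula_of_splitsHoriz hn hm hs.transpose hU h₁ h₂
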